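/- **Setting.** Let $F=GF(q)\subset K=GF(q^m)$. The support of a vector over $K$ is the $F$-space generated by its coordinates, and its rank is the dimension of its support. Let $n,k,d,t,r',l$ be integers with $k\le n$, $n=(n-k)d$, $r'\le (n-k)/d$, put $r=t+r'$, and suppose $r(2d-1)\le m$. A RankSign secret key consists of: an $F$-space $V\subset K$ of dimension $d$ with a basis $f_1,\dots,f_d$ and two linearly independent elements $F_1,F_2\in V$ such that $\dim(F_1^{-1}V+F_2^{-1}V)=2d-1$; an $(n-k)\times n$ matrix $H=\sum_a f_aH_a$ with matrices $H_a$ over $F$ that together form an invertible $n\times n$ matrix over $F$; an $(n-k)\times t$ matrix $R$ over $K$; invertible matrices $A$ of size $n-k$ over $K$ and $P$ of size $n+t$ over $F$. The public key is $H'=A(R|H)P$. For a subspace $T$ of $K$, a vector $u\in K^{n-k}$ is $T$-decodable if there is a subspace $E$ of dimension $r$ with $\dim\langle VE\rangle=dr$ and $\dim(F_1^{-1}\langle VE\rangle\cap F_2^{-1}\langle VE\rangle)=r$, such that the coordinates of $u$ lie in $\langle VE\rangle$ and together with $\langle VT\rangle$ generate it. The decoder then returns the unique $e\in E^n$ with $He^T=u$;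 it fails on all other $u$. To sign a message $M$, one repeats the following until it succeeds: choose a random seed in $\{0,1\}^l$ and a random $\tau\in K^t$ with independent coordinates; let $y=\mathrm{hash}(M\|\mathrm{seed})\in K^{n-k}$; decode $A^{-1}y^T-R\tau^T$ with $T=\langle\tau\rangle$. If this gives $e$, the signature is $(x,\mathrm{seed})$ with $x^T=P^{-1}(\tau,e)^T$. A pair $(x,\mathrm{seed})$ is valid for $M$ if $x$ has rank $r$ and $H'x^T=\mathrm{hash}(M\|\mathrm{seed})$. The hash function is a random oracle. **Theorem.** (1) Fix any secret key. Let $x''$ be uniformly random among the vectors of $K^{n+t}$ of rank $r$, and $y''=H'x''^T$. Call $x''$ *decodable* if, writing $Px''=(\tau,x_H)$, the vector $\tau$ has rank $t$ and $Hx_H^T$ is $\langle\tau\rangle$-decodable. Then $x''$ fails to be decodable with probability at most $2/(q-1)$, and, conditionally on $x''$ being decodable (when that has positive probability), $(x'',y'')$ has exactly the distribution of a genuine pair (signature vector, hash value), that is, of the pair obtained by the signer when each attempt uses a new uniformly random hash value. (2) Consider probabilistic algorithms, given as computation trees over $K$, which get the public key as input and may perform field operations, tests for zero, coin tosses, sampling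 in $F$ and in $K$, calls to the random oracle and (adaptive, chosen-message) requests for authentic signatures, each counted as one step. For every such algorithm $\mathcal A$ that uses at most $N\le q/2$ authentic signatures there is an algorithm $\mathcal A'$, not depending on the key, that uses no authentic signature, makes at most as many hash calls, has worst-case running time at most that of $\mathcal A$ plus $N\bigl(3(n+t+1)(r+n-k+1)+l\bigr)$, and satisfies the following for every key. For every triple $o$ = (message, seed, vector), let $p(o)$ be the probability that $\mathcal A$ outputs $o$ as a forgery (a valid signature of a message for which no authentic signature was requested) in a run with fresh hash calls, i.e. one in which every hash input of the signer is new and no later hash call of $\mathcal A$ hits an input that the signer rejected; and let $p'(o)$ be the probability that $\mathcal A'$, from the public key alone, outputs $o$ as a forgery. Then $$p'(o)\ \ge\ \Bigl(\max\bigl(0,\,1-\tfrac{2}{q-1}\bigr)\Bigr)^{N}p(o),$$ and in particular $p'(o)\ge p(o)/9$ if $q\ge 4$. Summing over $o$ gives the same bounds for the total probabilities of forgery. -/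

import Mathlib

open scoped ENNReal

noncomputable section

namespace RankSign

/-! ### Rank metric.  `F` is the field with `q` elements, `K` its extension of degree `m`. -/

/-- The rank weight of a vector over `K`: the dimension over `F` of its support, the `F`-space
generated by its coordinates. -/
def rankWeight (F : Type*) {K : Type*} [Field F] [Field K] [Algebra F K] {ι : Type*}
    (x : ι → K) : ℕ :=
  Module.finrank F (Submodule.span F (Set.range x))

/-- The space `a V`, for a scalar `a` of `K` and an `F`-subspace `V` of `K`. -/
def scale {F K : Type*} [Field F] [Field K] [Algebra F K] (a : K) (V : Submodule F K) :
    Submodule F K :=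
  V.map (LinearMap.mulLeft F a)

/-- `s` is `T`-decodable, for the space `V` with its two distinguished elements `F₁`, `F₂`, and the
rank `r`.  The product `V * E` of submodules is the space generated by the products `f e`. -/
def TDecodable {F K : Type*} [Field F] [Field K] [Algebra F K]
    (V : Submodule F K) (F₁ F₂ : K) (r : ℕ) (T : Submodule F K) {c : ℕ} (s : Fin c → K) : Prop :=
  ∃ E : Submodule F K, Module.finrank F E = r ∧
    Module.finrank F ↥(V * E) = Module.finrank F V * Module.finrank F E ∧
    Module.finrank F ↥(scale F₁⁻¹ (V * E) ⊓ scale F₂⁻¹ (V * E)) = Module.finrank F E ∧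
    (∀ i, s i ∈ V * E) ∧
    Submodule.span F (Set.range s) ⊔ V * T = V * E

/-! ### Keys.  `c` stands for the number `n - k` of rows of the parity-check matrices. -/

/-- A secret key: an augmented LRPC parity-check matrix `(R|H)`, with the entries of `H` in a space
of dimension `d`, and the masks `A`, `P`. -/
structure SecretKey (F K : Type*) [Field F] [Field K] [Algebra F K] (n c d t : ℕ) where
  /-- the left mask, invertible over the large field -/
  A : Matrix (Fin c) (Fin c) K
  isUnit_A : IsUnit A
  /-- the added columns -/
  R : Matrix (Fin c) (Fin t) K
  /-- the right mask, invertible over the small field -/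
  P : Matrix (Fin t ⊕ Fin n) (Fin t ⊕ Fin n) F
  isUnit_P : IsUnit P
  /-- a basis of the space that contains the entries of `H` -/
  basis : Fin d → K
  linearIndependent_basis : LinearIndependent F basis
  /-- the two fixed elements of that space that are used for decoding -/
  F₁ : K
  F₂ : K
  F₁_mem : F₁ ∈ Submodule.span F (Set.range basis)
  F₂_mem : F₂ ∈ Submodule.span F (Set.range basis)
  linearIndependent_F : LinearIndependent F ![F₁, F₂]
  /-- the coordinates of `H` in the basis, a square matrix over the small field -/
  Hf : Matrix (Fin c × Fin d) (Fin n) F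
  bijective_Hf : Function.Bijective Hf.mulVec
  finrank_sup :
    Module.finrank F ↥(scale F₁⁻¹ (Submodule.span F (Set.range basis)) ⊔
      scale F₂⁻¹ (Submodule.span F (Set.range basis))) = 2 * d - 1

section Scheme

variable {F K : Type*} [Field F] [Field K] [Algebra F K] {n c d t : ℕ}

/-- The space that contains the entries of `H`. -/
def SecretKey.space (sk : SecretKey F K n c d t) : Submodule F K :=
  Submodule.span F (Set.range sk.basis)

/-- The LRPC matrix. -/
def SecretKey.H (sk : SecretKey F K n c d t) : Matrix (Fin c) (Fin n) K :=
  Matrix.of fun i j => ∑ a, sk.Hf (i, a) j • sk.basis a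

/-- The matrix `P` over the large field. -/
def SecretKey.PK (sk : SecretKey F K n c d t) :
    Matrix (Fin t ⊕ Fin n) (Fin t ⊕ Fin n) K :=
  sk.P.map (algebraMap F K)

/-- The public key `H' = A (R|H) P`. -/
def SecretKey.publicKey (sk : SecretKey F K n c d t) : Matrix (Fin c) (Fin t ⊕ Fin n) K :=
  sk.A * Matrix.fromCols sk.R sk.H * sk.PK

/-- The support recovered by the decoder: `E = F₁⁻¹ S ∩ F₂⁻¹ S`, where `S` is generated by the
space `⟨V T⟩` and by the coordinates of the syndrome. -/
def SecretKey.recoveredSupport (sk : SecretKey F K n c d t) (T : Submodule F K)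
    (s : Fin c → K) : Submodule F K :=
  scale sk.F₁⁻¹ (Submodule.span F (Set.range s) ⊔ sk.space * T) ⊓
    scale sk.F₂⁻¹ (Submodule.span F (Set.range s) ⊔ sk.space * T)

open Classical in
/-- The errors/erasures decoder: on a `T`-decodable syndrome `s` it returns the solution of
`H eᵀ = s` with coordinates in the recovered support, otherwise it fails. -/
def SecretKey.decode (sk : SecretKey F K n c d t) (r : ℕ) (T : Submodule F K) (s : Fin c → K) :
    Option (Fin n → K) :=
  if h : TDecodable sk.space sk.F₁ sk.F₂ r T s ∧
      ∃ e : Fin n → K, (∀ j, e j ∈ sk.recoveredSupport T s) ∧ sk.H.mulVec e = s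
  then some h.2.choose else none

/-- The vector that the signer obtains from the hash value `s` and from the independent elements
`τ`, if the decoding of `A⁻¹ sᵀ - R τᵀ` with the erasure space `⟨τ⟩` succeeds. -/
def SecretKey.signatureOf (sk : SecretKey F K n c d t) (r : ℕ) (s : Fin c → K) (τ : Fin t → K) :
    Option (Fin t ⊕ Fin n → K) :=
  (sk.decode r (Submodule.span F (Set.range τ)) (sk.A⁻¹.mulVec s - sk.R.mulVec τ)).map
    fun e => sk.PK⁻¹.mulVec (Sum.elim τ e)

/-- `x` is decodable: `P x = (τ, x_H)` with `τ` of maximal rank `t`, and `H x_Hᵀ` is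
`⟨τ⟩`-decodable. -/
def SecretKey.Decodable (sk : SecretKey F K n c d t) (r : ℕ) (x : Fin t ⊕ Fin n → K) : Prop :=
  LinearIndependent F (fun i => sk.PK.mulVec x (Sum.inl i)) ∧
    TDecodable sk.space sk.F₁ sk.F₂ r
      (Submodule.span F (Set.range fun i => sk.PK.mulVec x (Sum.inl i)))
      (sk.H.mulVec fun j => sk.PK.mulVec x (Sum.inr j))

end Scheme

/-! ### Laws of genuine and of simulated pairs (signature, hash value) -/

section Laws

variable {F K : Type*} [Field F] [Field K] [Fintype K] [Algebra F K] {n c d t : ℕ}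

/-- A uniformly random element of a finite set; `none` if the set is empty. -/
def uniformOn {α : Type*} (s : Finset α) : PMF (Option α) :=
  if h : s.Nonempty then (PMF.uniformOfFinset s h).map some else PMF.pure none

open Classical in
/-- The tuples of `t` independent elements. -/
def independentTuples (F K : Type*) [Field F] [Field K] [Fintype K] [Algebra F K] (t : ℕ) :
    Finset (Fin t → K) :=
  Finset.univ.filter fun τ => LinearIndependent F τ

open Classical in
/-- The vectors of rank weight `r`. -/
def rankVectors (F K : Type*) [Field F] [Field K] [Fintype K] [Algebra F K] (t n r : ℕ) :
    Finset (Fin t ⊕ Fin n → K) :=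
  Finset.univ.filter fun x => rankWeight F x = r

/-- One signing attempt with hash value `s`: random independent `τ`, then decoding. -/
def SecretKey.attempt (sk : SecretKey F K n c d t) (r : ℕ) (s : Fin c → K) :
    PMF (Option (Fin t ⊕ Fin n → K)) :=
  (uniformOn (independentTuples F K t)).map fun τ? => τ?.bind (sk.signatureOf r s)

/-- One signing attempt with a new, uniformly random hash value; on success it returns the
signature and the hash value. -/
def SecretKey.freshAttempt (sk : SecretKey F K n c d t) (r : ℕ) :
    PMF (Option ((Fin t ⊕ Fin n → K) × (Fin c → K))) :=
  (PMF.uniformOfFintype (Fin c → K)).bind fun s =>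
    (sk.attempt r s).map fun x? => x?.map fun x => (x, s)

/-- The probability that the signer, who repeats independent attempts with new hash values until
one succeeds, ends with the pair `p`: the sum over `j` of the probability that the first `j`
attempts fail and the next one returns `p`. -/
def SecretKey.genuineLaw (sk : SecretKey F K n c d t) (r : ℕ)
    (p : (Fin t ⊕ Fin n → K) × (Fin c → K)) : ℝ≥0∞ :=
  ∑' j : ℕ, sk.freshAttempt r none ^ j * sk.freshAttempt r (some p)

/-- The simulated pair `(x, H' xᵀ)`, for a uniformly random vector `x` of rank weight `r`. -/
def simulatedPair (F : Type*) {K : Type*} [Field F] [Field K] [Fintype K] [Algebra F K]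
    {n c t : ℕ} (H' : Matrix (Fin c) (Fin t ⊕ Fin n) K) (r : ℕ)
    (h : (rankVectors F K t n r).Nonempty) : PMF ((Fin t ⊕ Fin n → K) × (Fin c → K)) :=
  (PMF.uniformOfFinset (rankVectors F K t n r) h).map fun x => (x, H'.mulVec x)

end Laws

/-! ### Algorithms: probabilistic computation trees over `K` with oracles -/

/-- What an instruction may read: an entry of the public key, or the value of the memory with a
given address (addresses are in the order of writing; what is not yet written reads as `0`). -/
inductive Operand (n c t : ℕ) where
  | key (i : Fin c) (j : Fin t ⊕ Fin n)
  | reg (a : ℕ)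

/-- The arithmetic instructions. -/
inductive Arith (K : Type*) (n c t : ℕ) where
  | const (a : K)
  | add (u v : Operand n c t)
  | sub (u v : Operand n c t)
  | mul (u v : Operand n c t)
  | inv (u : Operand n c t)

/-- An algorithm whose input is a public key.  Field elements are handled by the arithmetic
instructions and are only seen through tests for zero; messages, seeds and hash inputs are strings
that depend on the results of tests, on coins and on the seeds of received signatures. -/
inductive Algorithm (K : Type*) (n c t l : ℕ) where
  /-- stop, with a message, a seed, and a vector read from the memory -/
  | output (M : List Bool) (seed : Fin l → Bool) (x : Fin t ⊕ Fin n → Operand n c t)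
  /-- append the result of an arithmetic instruction to the memory -/
  | arith (op : Arith K n c t) (next : Algorithm K n c t l)
  /-- branch on whether a value is zero -/
  | test (u : Operand n c t) (ifZero ifNonzero : Algorithm K n c t l)
  /-- toss a fair coin -/
  | coin (next : Bool → Algorithm K n c t l)
  /-- append a random element of the small field to the memory -/
  | randSmall (next : Algorithm K n c t l)
  /-- append a random element of the large field to the memory -/
  | randLarge (next : Algorithm K n c t l)
  /-- call the hash function on a string; its value is appended to the memory -/
  | hash (w : List Bool) (next : Algorithm K n c t l)
  /-- ask for an authentic signature of a message; the vector is appended to the memory -/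
  | sign (M : List Bool) (next : (Fin l → Bool) → Algorithm K n c t l)

namespace Algorithm

variable {K : Type*} {n c t l : ℕ}

/-- The running time in the worst case: every instruction and every oracle call is one step. -/
def cost : Algorithm K n c t l → ℕ
  | output _ _ _ => 1
  | arith _ next => next.cost + 1
  | test _ a b => max a.cost b.cost + 1
  | coin next => max (next true).cost (next false).cost + 1
  | randSmall next => next.cost + 1
  | randLarge next => next.cost + 1
  | hash _ next => next.cost + 1
  | sign _ next => (Finset.univ.sup fun seed => (next seed).cost) + 1

/-- The number of hash calls in the worst case. -/
def hashCalls : Algorithm K n c t l → ℕ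
  | output _ _ _ => 0
  | arith _ next => next.hashCalls
  | test _ a b => max a.hashCalls b.hashCalls
  | coin next => max (next true).hashCalls (next false).hashCalls
  | randSmall next => next.hashCalls
  | randLarge next => next.hashCalls
  | hash _ next => next.hashCalls + 1
  | sign _ next => Finset.univ.sup fun seed => (next seed).hashCalls

/-- The number of authentic signatures used in the worst case. -/
def signCalls : Algorithm K n c t l → ℕ
  | output _ _ _ => 0
  | arith _ next => next.signCalls
  | test _ a b => max a.signCalls b.signCalls
  | coin next => max (next true).signCalls (next false).signCalls
  | randSmall next => next.signCalls
  | randLarge next => next.signCalls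
  | hash _ next => next.signCalls
  | sign _ next => (Finset.univ.sup fun seed => (next seed).signCalls) + 1

end Algorithm

/-! ### Forgery in the random oracle model -/

/-- The state of a run: the memory of the algorithm; the values of the random oracle that have been
drawn so far; the messages signed so far; the hash inputs that the signer has tried without
success; and whether all hash calls have been fresh so far, in the sense that every hash input of
the signer was new and no later hash call of the algorithm hit one that the signer rejected. -/
structure State (K : Type*) (c : ℕ) where
  mem : List K
  table : List Bool → Option (Fin c → K)
  signed : List (List Bool)
  rejected : List (List Bool)
  fresh : Bool

/-- The initial state. -/
def State.init (K : Type*) (c : ℕ) : State K c where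
  mem := []
  table := fun _ => none
  signed := []
  rejected := []
  fresh := true

section Game

variable {F K : Type*} [Field F] [Field K] [Fintype F] [Fintype K] [Algebra F K] {n c d t l : ℕ}

/-- The value of the random oracle at `w`: the old one if there is one, else a uniform one. -/
def oracleValue (table : List Bool → Option (Fin c → K)) (w : List Bool) : PMF (Fin c → K) :=
  match table w with
  | some y => PMF.pure y
  | none => PMF.uniformOfFintype (Fin c → K)

/-- A signing oracle; `none` means that it never answers. -/
abbrev Signer (K : Type*) (n c t l : ℕ) : Type _ :=
  List Bool → State K c → PMF (Option ((Fin t ⊕ Fin n → K) × (Fin l → Bool) × State K c))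

/-- The authentic signer, stopped after a given number of attempts.  An attempt picks a random
seed, hashes `M || seed`, picks `t` random independent elements and decodes. -/
def SecretKey.signer (sk : SecretKey F K n c d t) (r : ℕ) : ℕ → Signer K n c t l
  | 0 => fun _ _ => PMF.pure none
  | L + 1 => fun M st =>
      (PMF.uniformOfFintype (Fin l → Bool)).bind fun seed =>
      (oracleValue st.table (M ++ List.ofFn seed)).bind fun s =>
      (sk.attempt r s).bind fun x? =>
      let st' : State K c :=
        { st with
          table := Function.update st.table (M ++ List.ofFn seed) (some s)
          fresh := st.fresh && (st.table (M ++ List.ofFn seed)).isNone }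
      match x? with
      | some x => PMF.pure (some (x, seed, { st' with signed := M :: st.signed }))
      | none =>
          SecretKey.signer sk r L M
            { st' with rejected := (M ++ List.ofFn seed) :: st.rejected }

/-- No signer. -/
def noSigner : Signer K n c t l := fun _ _ => PMF.pure none

/-- The value of an operand. -/
def Operand.eval (H' : Matrix (Fin c) (Fin t ⊕ Fin n) K) (mem : List K) : Operand n c t → K
  | .key i j => H' i j
  | .reg a => mem.getD a 0

/-- The value of an arithmetic instruction. -/
def Arith.eval (H' : Matrix (Fin c) (Fin t ⊕ Fin n) K) (mem : List K) : Arith K n c t → K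
  | .const a => a
  | .add u v => u.eval H' mem + v.eval H' mem
  | .sub u v => u.eval H' mem - v.eval H' mem
  | .mul u v => u.eval H' mem * v.eval H' mem
  | .inv u => (u.eval H' mem)⁻¹

open Classical in
/-- The run of an algorithm on the public key `H'`, with the random oracle and a signing oracle.
The result is the triple (message, seed, vector) that is output, provided that all hash calls were
fresh and that the triple is a forgery: the message was not signed by the signing oracle, and the
signature passes verification.  Otherwise the result is `none`. -/
def run (F : Type*) {K : Type*} [Field F] [Field K] [Fintype F] [Fintype K] [Algebra F K]
    {n c t l : ℕ} (H' : Matrix (Fin c) (Fin t ⊕ Fin n) K) (r : ℕ) (signer : Signer K n c t l) :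
    Algorithm K n c t l → State K c →
      PMF (Option (List Bool × (Fin l → Bool) × (Fin t ⊕ Fin n → K)))
  | .output M seed x, st =>
      (oracleValue st.table (M ++ List.ofFn seed)).map fun y =>
        if st.fresh = true ∧ M ∉ st.signed ∧ rankWeight F (fun i => (x i).eval H' st.mem) = r ∧
            H'.mulVec (fun i => (x i).eval H' st.mem) = y
        then some (M, seed, fun i => (x i).eval H' st.mem) else none
  | .arith op next, st =>
      run F H' r signer next { st with mem := st.mem ++ [op.eval H' st.mem] }
  | .test u a b, st =>
      if u.eval H' st.mem = 0 then run F H' r signer a st else run F H' r signer b st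
  | .coin next, st =>
      (PMF.uniformOfFintype Bool).bind fun b => run F H' r signer (next b) st
  | .randSmall next, st =>
      (PMF.uniformOfFintype F).bind fun a =>
        run F H' r signer next { st with mem := st.mem ++ [algebraMap F K a] }
  | .randLarge next, st =>
      (PMF.uniformOfFintype K).bind fun a =>
        run F H' r signer next { st with mem := st.mem ++ [a] }
  | .hash w next, st =>
      (oracleValue st.table w).bind fun y =>
        run F H' r signer next
          { st with
            mem := st.mem ++ List.ofFn y
            table := Function.update st.table w (some y)
            fresh := st.fresh && decide (w ∉ st.rejected) }
  | .sign M next, st =>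
      (signer M st).bind fun ans =>
        match ans with
        | none => PMF.pure none
        | some (x, seed, st') =>
            run F H' r signer (next seed)
              { st' with
                mem := st'.mem ++ List.ofFn (fun i => x (Sum.inl i)) ++
                  List.ofFn (fun j => x (Sum.inr j)) }

/-- The probability that the algorithm, with access to authentic signatures, outputs the forgery
`o` in a run with fresh hash calls.  The signer repeats its attempts until it succeeds: the
probability is the limit (the supremum) over the bounds on the number of attempts. -/
def forgeryProb (sk : SecretKey F K n c d t) (r : ℕ) (𝒜 : Algorithm K n c t l)
    (o : List Bool × (Fin l → Bool) × (Fin t ⊕ Fin n → K)) : ℝ≥0∞ :=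
  ⨆ L : ℕ, run F sk.publicKey r (sk.signer r L) 𝒜 (State.init K c) (some o)

/-- The probability that the algorithm, from the public key alone and without any authentic
signature, outputs the forgery `o`. -/
def keyOnlyForgeryProb (F : Type*) {K : Type*} [Field F] [Field K] [Fintype F] [Fintype K]
    [Algebra F K] {n c t l : ℕ} (H' : Matrix (Fin c) (Fin t ⊕ Fin n) K) (r : ℕ)
    (𝒜 : Algorithm K n c t l)
    (o : List Bool × (Fin l → Bool) × (Fin t ⊕ Fin n → K)) : ℝ≥0∞ :=
  run F H' r noSigner 𝒜 (State.init K c) (some o)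

end Game

end RankSign

end

open scoped ENNReal

noncomputable section

namespace RankSign

/-! ### Products of subspaces -/

section Subspaces

variable {F K : Type*} [Field F] [Field K] [Algebra F K]

/-! Write a vector as `x = X e`, with `e` in `K^r` and a coordinate matrix `X` over `F`. Every
vector of rank `r` arises from the same number of pairs `(e, X)`, namely the number of bases of its
support, so probabilities over vectors of rank `r` can be estimated by counting pairs.

If `e` satisfies no nontrivial relation with coefficients in `F₁⁻¹V + F₂⁻¹V`, which has dimension
`2d - 1`, then `E = ⟨e⟩` meets the decoder's conditions: `VE` has dimension `dr`, the sum of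
`F₁⁻¹VE` and `F₂⁻¹VE` has dimension `(2d-1)r`, and so their intersection has dimension `r`. Since
`P` and the matrix `Hf` are invertible over `F`, the coordinates of the erasures and of the syndrome
are independent and uniform when `X` is. Three events suffice for decodability: independence of `e`,
independence of the erasures, and generation of `VE` by the syndrome together with the erasures. A
union bound over lines (`card_exists_eq_zero_le`) bounds each failure, and the product of the three
success probabilities is at least `1 - 2/(q-1)` (`le_card_signatures`).

The decoder returns `x` for the hash value `s` and the erasures `τ` exactly when `x` is decodable of
rank `r`, `H'x = s`, and `τ` is the first block of `Px` (`signatureOf_eq_some_iff`). Each signature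
thus has the same probability in an attempt with a new hash value, and the signer's law is uniform
on signatures (`genuineLaw_apply`). A uniform vector of rank `r`, conditioned on decodability, has
the same law. This is part (1).

For part (2), `simulate` answers a signature request with a random seed and `x = X e`, and declares
`H'x` to be the hash value of the message with that seed. The law of `X e` dominates `1 - 2/(q-1)`
times the signer's law pointwise (`sum_genuineLaw_le`), so each request costs this factor at most.
Domination is enough, and no rank or decodability is ever tested in the simulation. Hash inputs
rejected by the signer are unknown to the simulation, but they belong to signed messages and are not
hit in a fresh run; hence on the inputs that matter both oracles agree (`mul_run_le_run_simulate`).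
-/

theorem scale_eq_span_mul (a : K) (V : Submodule F K) :
    scale a V = Submodule.span F {a} * V := by
  ext x
  rw [Submodule.mem_span_singleton_mul]
  simp [scale, Submodule.mem_map]

theorem scale_mul (a : K) (V E : Submodule F K) : scale a (V * E) = scale a V * E := by
  simp only [scale_eq_span_mul, mul_assoc]

theorem mem_scale_inv {a : K} (ha : a ≠ 0) {V : Submodule F K} {x : K} :
    x ∈ scale a⁻¹ V ↔ a * x ∈ V := by
  rw [scale_eq_span_mul, Submodule.mem_span_singleton_mul]
  constructor
  · rintro ⟨z, hz, rfl⟩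
    rwa [mul_inv_cancel_left₀ ha]
  · intro h
    exact ⟨a * x, h, inv_mul_cancel_left₀ ha x⟩

theorem finrank_scale {a : K} (ha : a ≠ 0) (V : Submodule F K) :
    Module.finrank F (scale a V) = Module.finrank F V :=
  (LinearEquiv.finrank_eq (Submodule.equivMapOfInjective (LinearMap.mulLeft F a)
    (mul_right_injective₀ ha) V)).symm

/-- The map `w ↦ ∑ w_b e_b` on vectors over a subspace `W`. -/
def combination {ι : Type*} [Fintype ι] (W : Submodule F K) (e : ι → K) : (ι → W) →ₗ[F] K where
  toFun w := ∑ b, (w b : K) * e b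
  map_add' w w' := by simp [add_mul, Finset.sum_add_distrib]
  map_smul' a w := by simp [Finset.smul_sum]

theorem combination_apply {ι : Type*} [Fintype ι] (W : Submodule F K) (e : ι → K) (w : ι → W) :
    combination W e w = ∑ b, (w b : K) * e b := rfl

/-- The family `e` is independent over the subspace `W`: there are no nontrivial relations with
coefficients in `W`. -/
def IndependentOver {ι : Type*} [Fintype ι] (W : Submodule F K) (e : ι → K) : Prop :=
  ∀ w : ι → W, combination W e w = 0 → w = 0

variable {ι : Type*}

theorem span_products {κ : Type*} (f : κ → K) (e : ι → K) :
    Submodule.span F (Set.range fun p : κ × ι => f p.1 * e p.2) =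
      Submodule.span F (Set.range f) * Submodule.span F (Set.range e) := by
  rw [Submodule.span_mul_span]
  congr 1
  ext x
  simp [Set.mem_mul]

variable [Fintype ι]

theorem IndependentOver.mono {V W : Submodule F K} {e : ι → K} (h : IndependentOver W e)
    (hVW : V ≤ W) : IndependentOver V e := by
  intro v hv
  have := h (fun b => ⟨v b, hVW (v b).2⟩) hv
  funext b
  have hb := congrFun this b
  exact Subtype.ext (congrArg (fun w : W => (w : K)) hb)

theorem range_combination (W : Submodule F K) (e : ι → K) :
    LinearMap.range (combination W e) = W * Submodule.span F (Set.range e) := by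
  apply le_antisymm
  · rintro _ ⟨w, rfl⟩
    exact Submodule.sum_mem _ fun b _ =>
      Submodule.mul_mem_mul (w b).2 (Submodule.subset_span ⟨b, rfl⟩)
  · rw [Submodule.mul_le]
    intro w hw z hz
    obtain ⟨a, rfl⟩ := (Submodule.mem_span_range_iff_exists_fun F).1 hz
    refine ⟨fun b => a b • ⟨w, hw⟩, ?_⟩
    simp [combination_apply, Finset.mul_sum]

theorem IndependentOver.finrank_mul {W : Submodule F K} {e : ι → K} [FiniteDimensional F K]
    (h : IndependentOver W e) :
    Module.finrank F ↥(W * Submodule.span F (Set.range e)) =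
      Module.finrank F W * Fintype.card ι := by
  rw [← range_combination, LinearMap.finrank_range_of_inj
    ((injective_iff_map_eq_zero _).2 h), Module.finrank_pi_fintype]
  simp [mul_comm]

theorem IndependentOver.linearIndependent {W : Submodule F K} {e : ι → K}
    (h : IndependentOver W e) (hW : W ≠ ⊥) : LinearIndependent F e := by
  obtain ⟨w, hw, hw0⟩ := Submodule.exists_mem_ne_zero_of_ne_bot hW
  rw [Fintype.linearIndependent_iff]
  intro g hg b
  have h1 := h (fun b => g b • ⟨w, hw⟩) (by
    have : ∑ b, w * (g b • e b) = 0 := by rw [← Finset.mul_sum, hg, mul_zero]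
    simpa [combination_apply] using this)
  have h2 := congrArg Subtype.val (congrFun h1 b)
  simpa [hw0] using h2

theorem linearIndependent_products {κ : Type*} [Fintype κ] {f : κ → K} {e : ι → K}
    (h : Module.finrank F ↥(Submodule.span F (Set.range f) * Submodule.span F (Set.range e)) =
      Fintype.card κ * Fintype.card ι) :
    LinearIndependent F fun p : κ × ι => f p.1 * e p.2 := by
  rw [linearIndependent_iff_card_eq_finrank_span, Set.finrank, span_products, h,
    Fintype.card_prod]

theorem finrank_mul_le [FiniteDimensional F K] (V E : Submodule F K) :
    Module.finrank F ↥(V * E) ≤ Module.finrank F V * Module.finrank F E := by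
  set f := fun i => ((Module.finBasis F V) i : K)
  set e := fun i => ((Module.finBasis F E) i : K)
  have hf : Submodule.span F (Set.range f) = V := by
    have := congrArg (Submodule.map V.subtype) (Module.finBasis F V).span_eq
    rwa [Submodule.map_span, ← Set.range_comp, Submodule.map_top, Submodule.range_subtype] at this
  have he : Submodule.span F (Set.range e) = E := by
    have := congrArg (Submodule.map E.subtype) (Module.finBasis F E).span_eq
    rwa [Submodule.map_span, ← Set.range_comp, Submodule.map_top, Submodule.range_subtype] at this
  conv_lhs => rw [← hf, ← he, ← span_products]
  refine (finrank_range_le_card _).trans ?_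
  simp

end Subspaces

/-! ### The decoder -/

section Decoder

variable {F K : Type*} [Field F] [Field K] [Algebra F K] {n c d t : ℕ}
  (sk : SecretKey F K n c d t)

namespace SecretKey

theorem finrank_space : Module.finrank F sk.space = d := by
  rw [space, finrank_span_eq_card sk.linearIndependent_basis, Fintype.card_fin]

theorem F₁_ne_zero : sk.F₁ ≠ 0 := sk.linearIndependent_F.ne_zero 0

theorem F₂_ne_zero : sk.F₂ ≠ 0 := sk.linearIndependent_F.ne_zero 1

theorem two_le [FiniteDimensional F K] (sk : SecretKey F K n c d t) : 2 ≤ d := by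
  have h : Submodule.span F (Set.range ![sk.F₁, sk.F₂]) ≤ sk.space := by
    rw [Submodule.span_le]
    rintro _ ⟨i, rfl⟩
    fin_cases i
    · exact sk.F₁_mem
    · exact sk.F₂_mem
  have := Submodule.finrank_mono h
  rwa [finrank_span_eq_card sk.linearIndependent_F, Fintype.card_fin, finrank_space] at this

/-- The space `F₁⁻¹ V + F₂⁻¹ V`. -/
def sumSpace : Submodule F K := scale sk.F₁⁻¹ sk.space ⊔ scale sk.F₂⁻¹ sk.space

theorem finrank_sumSpace : Module.finrank F sk.sumSpace = 2 * d - 1 := sk.finrank_sup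

/-- The conditions on the space `E` that are part of the definition of decodability. -/
def GoodSupport (r : ℕ) (E : Submodule F K) : Prop :=
  Module.finrank F E = r ∧ Module.finrank F ↥(sk.space * E) = d * r ∧
    scale sk.F₁⁻¹ (sk.space * E) ⊓ scale sk.F₂⁻¹ (sk.space * E) = E

theorem le_inf_scale (E : Submodule F K) :
    E ≤ scale sk.F₁⁻¹ (sk.space * E) ⊓ scale sk.F₂⁻¹ (sk.space * E) := by
  intro x hx
  rw [Submodule.mem_inf, mem_scale_inv sk.F₁_ne_zero, mem_scale_inv sk.F₂_ne_zero]
  exact ⟨Submodule.mul_mem_mul sk.F₁_mem hx, Submodule.mul_mem_mul sk.F₂_mem hx⟩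

/-- `E` always lies in the intersection, because `F₁` and `F₂` belong to `V`; so the condition on
its dimension amounts to an equality of spaces. Membership of the coordinates follows from the
generation condition. -/
theorem tDecodable_iff [FiniteDimensional F K] {r : ℕ} {T : Submodule F K} {s : Fin c → K} :
    TDecodable sk.space sk.F₁ sk.F₂ r T s ↔ ∃ E, sk.GoodSupport r E ∧
      Submodule.span F (Set.range s) ⊔ sk.space * T = sk.space * E := by
  constructor
  · rintro ⟨E, h1, h2, h3, -, h5⟩
    refine ⟨E, ⟨h1, by rw [h2, h1, finrank_space], ?_⟩, h5⟩
    exact (Submodule.eq_of_le_of_finrank_eq (sk.le_inf_scale E) h3.symm).symm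
  · rintro ⟨E, ⟨h1, h2, h3⟩, h5⟩
    refine ⟨E, h1, by rw [h2, h1, finrank_space], by rw [h3], fun i => ?_, h5⟩
    rw [← h5]
    exact Submodule.mem_sup_left (Submodule.subset_span ⟨i, rfl⟩)

/-- Independence over the sum passes to both summands, so the summands multiplied by `E` have
dimension `dr` and their sum has dimension `(2d-1)r`. The intersection then has dimension `2dr -
(2d-1)r = r`, and it contains `E`. -/
theorem goodSupport_of_independentOver [FiniteDimensional F K] {r : ℕ} {e : Fin r → K}
    (h : IndependentOver sk.sumSpace e) :
    sk.GoodSupport r (Submodule.span F (Set.range e)) := by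
  have hd := sk.two_le
  have h1 : IndependentOver (scale sk.F₁⁻¹ sk.space) e := h.mono le_sup_left
  have h2 : IndependentOver (scale sk.F₂⁻¹ sk.space) e := h.mono le_sup_right
  have f1 := h1.finrank_mul
  have f2 := h2.finrank_mul
  have f3 := h.finrank_mul
  have hE : LinearIndependent F e := by
    apply h.linearIndependent
    intro h0
    have := sk.finrank_sumSpace
    rw [h0, finrank_bot] at this
    omega
  have hr : Module.finrank F (Submodule.span F (Set.range e)) = r := by
    rw [finrank_span_eq_card hE, Fintype.card_fin]
  rw [finrank_scale (inv_ne_zero sk.F₁_ne_zero), finrank_space, Fintype.card_fin] at f1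
  rw [finrank_scale (inv_ne_zero sk.F₂_ne_zero), finrank_space, Fintype.card_fin] at f2
  rw [finrank_sumSpace, Fintype.card_fin, sumSpace, Submodule.sup_mul] at f3
  refine ⟨hr, ?_, ?_⟩
  · rwa [← scale_mul, finrank_scale (inv_ne_zero sk.F₁_ne_zero)] at f1
  · refine (Submodule.eq_of_le_of_finrank_eq (sk.le_inf_scale _) ?_).symm
    rw [hr, scale_mul, scale_mul]
    have := Submodule.finrank_sup_add_finrank_inf_eq
      (scale sk.F₁⁻¹ sk.space * Submodule.span F (Set.range e))
      (scale sk.F₂⁻¹ sk.space * Submodule.span F (Set.range e))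
    rw [f1, f2, f3] at this
    obtain ⟨k, rfl⟩ : ∃ k, d = k + 1 := ⟨d - 1, by omega⟩
    have e1 : 2 * (k + 1) - 1 = 2 * k + 1 := by omega
    rw [e1] at this
    nlinarith

/-- The coordinates of `H (X e)ᵀ` in the products of the basis of `V` with the family `e`. -/
def coordinates {r : ℕ} (X : Fin n → Fin r → F) (i : Fin c) (p : Fin d × Fin r) : F :=
  ∑ j, sk.Hf (i, p.1) j * X j p.2

theorem coordinates_injective {r : ℕ} :
    Function.Injective (sk.coordinates : (Fin n → Fin r → F) → _) := by
  intro X X' h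
  funext j b
  refine congrFun (sk.bijective_Hf.1 (a₁ := fun j => X j b) (a₂ := fun j => X' j b) ?_) j
  funext p
  exact congrFun (congrFun h p.1) (p.2, b)

theorem H_mulVec {r : ℕ} (X : Fin n → Fin r → F) (e : Fin r → K) (i : Fin c) :
    sk.H.mulVec (fun j => ∑ b, X j b • e b) i =
      ∑ p : Fin d × Fin r, sk.coordinates X i p • (sk.basis p.1 * e p.2) := by
  simp only [Matrix.mulVec, dotProduct, H, Matrix.of_apply, coordinates, Finset.sum_smul,
    Finset.sum_mul, Finset.mul_sum, Fintype.sum_prod_type]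
  calc _ = ∑ j, ∑ a, ∑ b, sk.Hf (i, a) j • sk.basis a * X j b • e b :=
        Finset.sum_congr rfl fun j _ => Finset.sum_comm
    _ = ∑ a, ∑ j, ∑ b, sk.Hf (i, a) j • sk.basis a * X j b • e b := Finset.sum_comm
    _ = ∑ a, ∑ b, ∑ j, sk.Hf (i, a) j • sk.basis a * X j b • e b :=
        Finset.sum_congr rfl fun a _ => Finset.sum_comm
    _ = _ := by
        simp only [Algebra.smul_def, map_mul]
        refine Finset.sum_congr rfl fun a _ => Finset.sum_congr rfl fun b _ =>
          Finset.sum_congr rfl fun j _ => ?_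
        ring

/-- Dimension `dr` of `VE` makes the products of the two bases independent, so the syndrome
determines its coordinates in them; these determine the vector because `Hf` is invertible. -/
theorem H_injOn [FiniteDimensional F K] {r : ℕ} {E : Submodule F K} (hE : sk.GoodSupport r E)
    {x y : Fin n → K} (hx : ∀ j, x j ∈ E) (hy : ∀ j, y j ∈ E)
    (h : sk.H.mulVec x = sk.H.mulVec y) : x = y := by
  obtain ⟨h1, h2, -⟩ := hE
  subst h1
  set e := fun i => ((Module.finBasis F E) i : K)
  have he : Submodule.span F (Set.range e) = E := by
    have := congrArg (Submodule.map E.subtype) (Module.finBasis F E).span_eq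
    rwa [Submodule.map_span, ← Set.range_comp, Submodule.map_top, Submodule.range_subtype] at this
  have hli : LinearIndependent F fun p : Fin d × Fin _ => sk.basis p.1 * e p.2 := by
    apply linearIndependent_products
    rw [he, Fintype.card_fin, Fintype.card_fin]
    exact h2
  have hrep : ∀ x : Fin n → K, (∀ j, x j ∈ E) →
      ∃ X : Fin n → Fin (Module.finrank F E) → F, x = fun j => ∑ b, X j b • e b := by
    intro x hx
    have : ∀ j, ∃ a : Fin (Module.finrank F E) → F, ∑ b, a b • e b = x j := fun j =>
      (Submodule.mem_span_range_iff_exists_fun F).1 (by rw [he]; exact hx j)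
    choose X hX using this
    exact ⟨X, funext fun j => (hX j).symm⟩
  obtain ⟨X, rfl⟩ := hrep x hx
  obtain ⟨Y, rfl⟩ := hrep y hy
  have : X = Y := by
    apply sk.coordinates_injective
    funext i p
    have hi := congrFun h i
    rw [H_mulVec, H_mulVec] at hi
    exact hli.eq_coords_of_eq hi p
  rw [this]

theorem isUnit_PK : IsUnit sk.PK := by
  have := sk.isUnit_P.map (algebraMap F K).mapMatrix
  exact this

theorem PK_mulVec_inv (v : Fin t ⊕ Fin n → K) : sk.PK.mulVec (sk.PK⁻¹.mulVec v) = v := by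
  rw [Matrix.mulVec_mulVec, Matrix.mul_nonsing_inv _ ((Matrix.isUnit_iff_isUnit_det _).1
    sk.isUnit_PK), Matrix.one_mulVec]

theorem PK_inv_mulVec (v : Fin t ⊕ Fin n → K) : sk.PK⁻¹.mulVec (sk.PK.mulVec v) = v := by
  rw [Matrix.mulVec_mulVec, Matrix.nonsing_inv_mul _ ((Matrix.isUnit_iff_isUnit_det _).1
    sk.isUnit_PK), Matrix.one_mulVec]

/-- The support of a vector does not change under `P`. -/
theorem span_PK_mulVec (x : Fin t ⊕ Fin n → K) :
    Submodule.span F (Set.range (sk.PK.mulVec x)) = Submodule.span F (Set.range x) := by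
  have key : ∀ (Q : Matrix (Fin t ⊕ Fin n) (Fin t ⊕ Fin n) F) (x : Fin t ⊕ Fin n → K),
      Submodule.span F (Set.range ((Q.map (algebraMap F K)).mulVec x)) ≤
        Submodule.span F (Set.range x) := by
    intro Q x
    rw [Submodule.span_le]
    rintro _ ⟨i, rfl⟩
    rw [Matrix.mulVec, dotProduct]
    refine Submodule.sum_mem _ fun j _ => ?_
    rw [Matrix.map_apply, ← Algebra.smul_def]
    exact Submodule.smul_mem _ _ (Submodule.subset_span ⟨j, rfl⟩)
  apply le_antisymm (key _ _)
  have h := key sk.P⁻¹ (sk.PK.mulVec x)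
  have h1 : sk.P⁻¹.map (algebraMap F K) * sk.PK = 1 := by
    rw [PK, ← Matrix.map_mul, Matrix.nonsing_inv_mul _ ((Matrix.isUnit_iff_isUnit_det _).1
      sk.isUnit_P), Matrix.map_one _ (map_zero _) (map_one _)]
  rwa [Matrix.mulVec_mulVec, h1, Matrix.one_mulVec] at h

theorem publicKey_mulVec (x : Fin t ⊕ Fin n → K) :
    sk.publicKey.mulVec x = sk.A.mulVec (sk.R.mulVec (fun i => sk.PK.mulVec x (Sum.inl i)) +
      sk.H.mulVec fun j => sk.PK.mulVec x (Sum.inr j)) := by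
  rw [publicKey, ← Matrix.mulVec_mulVec, ← Matrix.mulVec_mulVec, Matrix.fromCols_mulVec]
  rfl

theorem syndrome_eq (x : Fin t ⊕ Fin n → K) :
    sk.A⁻¹.mulVec (sk.publicKey.mulVec x) -
      sk.R.mulVec (fun i => sk.PK.mulVec x (Sum.inl i)) =
      sk.H.mulVec fun j => sk.PK.mulVec x (Sum.inr j) := by
  rw [publicKey_mulVec, Matrix.mulVec_mulVec, Matrix.nonsing_inv_mul _
    ((Matrix.isUnit_iff_isUnit_det _).1 sk.isUnit_A), Matrix.one_mulVec, add_sub_cancel_left]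

theorem H_mulVec_mem {S : Submodule F K} {x : Fin n → K} (hx : ∀ j, x j ∈ S) (i : Fin c) :
    sk.H.mulVec x i ∈ sk.space * S := by
  rw [Matrix.mulVec, dotProduct]
  refine Submodule.sum_mem _ fun j _ => Submodule.mul_mem_mul ?_ (hx j)
  rw [H, Matrix.of_apply]
  exact Submodule.sum_mem _ fun a _ =>
    Submodule.smul_mem _ _ (Submodule.subset_span ⟨a, rfl⟩)

/-- The space generated by a syndrome and the erasures is contained in the product of `V` with the
support of the vector. -/
theorem span_syndrome_le (v : Fin t ⊕ Fin n → K) :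
    Submodule.span F (Set.range (sk.H.mulVec fun j => v (Sum.inr j))) ⊔
      sk.space * Submodule.span F (Set.range fun i => v (Sum.inl i)) ≤
      sk.space * Submodule.span F (Set.range v) := by
  apply sup_le
  · rw [Submodule.span_le]
    rintro _ ⟨i, rfl⟩
    refine sk.H_mulVec_mem (fun j => Submodule.subset_span ?_) i
    exact ⟨Sum.inr j, rfl⟩
  · refine mul_le_mul_right ?_ _
    apply Submodule.span_mono
    rintro _ ⟨i, rfl⟩
    exact ⟨_, rfl⟩

theorem recoveredSupport_eq {r : ℕ} {E T : Submodule F K} {s : Fin c → K}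
    (hE : sk.GoodSupport r E)
    (h : Submodule.span F (Set.range s) ⊔ sk.space * T = sk.space * E) :
    sk.recoveredSupport T s = E := by
  rw [recoveredSupport, h, hE.2.2]

/-- The vectors that occur as genuine signatures. -/
def IsSignature (r : ℕ) (x : Fin t ⊕ Fin n → K) : Prop :=
  sk.Decodable r x ∧ rankWeight F x = r

/-- Let `S` be the support of `Px`, which is that of `x`, and `E` the space in the definition of
decodability. The syndrome and the erasures generate `VE` inside `VS`. If the decoder succeeds, `S ≤
E`, and `dr ≤ d · dim S` forces rank `r`. Conversely, rank `r` forces `VE = VS`, whence `S ≤ E` and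
`S = E`; the decoder then finds `x` because `H` is injective on vectors over `E`. -/
theorem signatureOf_eq_some_iff [FiniteDimensional F K] {r : ℕ} {s : Fin c → K} {τ : Fin t → K}
    (hτ : LinearIndependent F τ) {x : Fin t ⊕ Fin n → K} :
    sk.signatureOf r s τ = some x ↔
      sk.IsSignature r x ∧ sk.publicKey.mulVec x = s ∧
        τ = fun i => sk.PK.mulVec x (Sum.inl i) := by
  have hd := sk.two_le
  constructor
  · intro h
    obtain ⟨e, he, rfl⟩ := Option.map_eq_some_iff.1 h
    unfold decode at he
    split_ifs at he with hc
    have hsp := hc.2.choose_spec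
    rw [Option.some.inj he] at hsp
    have hl : (fun i => sk.PK.mulVec (sk.PK⁻¹.mulVec (Sum.elim τ e)) (Sum.inl i)) = τ := by
      rw [PK_mulVec_inv]; rfl
    have hr : (fun i => sk.PK.mulVec (sk.PK⁻¹.mulVec (Sum.elim τ e)) (Sum.inr i)) = e := by
      rw [PK_mulVec_inv]; rfl
    refine ⟨⟨⟨?_, ?_⟩, ?_⟩, ?_, hl.symm⟩
    · rw [hl]; exact hτ
    · rw [hl, hr, hsp.2]; exact hc.1
    · obtain ⟨E, hE, hgen⟩ := sk.tDecodable_iff.1 hc.1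
      rw [sk.recoveredSupport_eq hE hgen] at hsp
      rw [rankWeight, ← span_PK_mulVec sk, PK_mulVec_inv]
      have hle : Submodule.span F (Set.range (Sum.elim τ e)) ≤ E := by
        rw [Submodule.span_le]
        rintro _ ⟨i | j, rfl⟩
        -- The erasures lie in the recovered support since `F₁ τ` and `F₂ τ` lie in `VT`.
        · rw [← hE.2.2, ← hgen]
          have hm : τ i ∈ Submodule.span F (Set.range τ) := Submodule.subset_span ⟨i, rfl⟩
          refine Submodule.mem_inf.2 ⟨(mem_scale_inv sk.F₁_ne_zero).2 ?_,
            (mem_scale_inv sk.F₂_ne_zero).2 ?_⟩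
          · exact Submodule.mem_sup_right (Submodule.mul_mem_mul sk.F₁_mem hm)
          · exact Submodule.mem_sup_right (Submodule.mul_mem_mul sk.F₂_mem hm)
        · exact hsp.1 j
      apply le_antisymm
      · exact (Submodule.finrank_mono hle).trans hE.1.le
      · have h1 := sk.span_syndrome_le (Sum.elim τ e)
        simp only [Sum.elim_inl, Sum.elim_inr] at h1
        rw [hsp.2] at h1
        have h2 := (Submodule.finrank_mono (hgen ▸ h1)).trans (finrank_mul_le _ _)
        rw [hE.2.1, finrank_space] at h2
        exact Nat.le_of_mul_le_mul_left h2 (by omega)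
    · rw [publicKey_mulVec, hl, hr, hsp.2, add_sub_cancel, Matrix.mulVec_mulVec,
        Matrix.mul_nonsing_inv _ ((Matrix.isUnit_iff_isUnit_det _).1 sk.isUnit_A),
        Matrix.one_mulVec]
  · rintro ⟨⟨⟨hli, hdec⟩, hrk⟩, rfl, rfl⟩
    obtain ⟨E, hE, hgen⟩ := sk.tDecodable_iff.1 hdec
    rw [rankWeight, ← span_PK_mulVec sk] at hrk
    set S := Submodule.span F (Set.range (sk.PK.mulVec x)) with hS
    have hle := sk.span_syndrome_le (sk.PK.mulVec x)
    rw [hgen] at hle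
    have heq : sk.space * E = sk.space * S := by
      apply Submodule.eq_of_le_of_finrank_le hle
      refine (finrank_mul_le _ _).trans ?_
      rw [hE.2.1, finrank_space, hrk]
    have hSE : S = E := by
      apply Submodule.eq_of_le_of_finrank_eq
      · rw [← hE.2.2, heq]
        exact sk.le_inf_scale S
      · rw [hrk, hE.1]
    have hmem : ∀ j, sk.PK.mulVec x (Sum.inr j) ∈ E := fun j =>
      hSE ▸ Submodule.subset_span ⟨_, rfl⟩
    have hrec := sk.recoveredSupport_eq hE hgen
    rw [signatureOf, syndrome_eq, decode, dif_pos ⟨hdec, _, by rwa [hrec], rfl⟩]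
    generalize_proofs pf
    have hsp := pf.choose_spec
    rw [Option.map_some]
    congr 1
    have h1 : pf.choose = fun j => sk.PK.mulVec x (Sum.inr j) := by
      apply sk.H_injOn hE _ hmem hsp.2
      rw [← hrec]
      exact hsp.1
    rw [h1]
    convert sk.PK_inv_mulVec x using 2
    funext i
    cases i <;> rfl

end SecretKey

end Decoder

/-! ### Counting -/

section UnionBound

variable {F U Z Y : Type*} [Field F] [Finite F] [AddCommGroup U] [Module F U] [Finite U]
  [AddCommGroup Z] [Module F Z] [Finite Z] [AddCommGroup Y] [Module F Y]

/-- The union bound for the event that a linear map, random in a linear family, kills a nonzero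
vector; proportional vectors are counted only once. -/
theorem card_exists_eq_zero_le (L : U →ₗ[F] Z →ₗ[F] Y)
    (hL : ∀ u, u ≠ 0 → Function.Surjective (L u)) :
    (Nat.card F - 1) * Nat.card {z // ∃ u, u ≠ 0 ∧ L u z = 0} * Nat.card Y ≤
      Nat.card U * Nat.card Z := by
  classical
  have := Fintype.ofFinite F
  have := Fintype.ofFinite U
  have := Fintype.ofFinite Z
  have hker : ∀ u, u ≠ 0 →
      (Finset.univ.filter fun z => L u z = 0).card * Nat.card Y = Nat.card Z := by
    intro u hu
    rw [Submodule.card_eq_card_quotient_mul_card (LinearMap.ker (L u)),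
      Nat.card_congr ((L u).quotKerEquivOfSurjective (hL u hu)).toEquiv]
    congr 1
    rw [← Fintype.card_subtype, ← Nat.card_eq_fintype_card]
    rfl
  have hbad : ∀ z ∈ Finset.univ.filter fun z => ∃ u, u ≠ 0 ∧ L u z = 0,
      Nat.card F - 1 ≤ (Finset.univ.filter fun u => u ≠ 0 ∧ L u z = 0).card := by
    intro z hz
    obtain ⟨u, hu, huz⟩ := (Finset.mem_filter.1 hz).2
    rw [Nat.card_eq_fintype_card, ← Fintype.card_units, ← Finset.card_univ]
    refine Finset.card_le_card_of_injOn (fun a : Fˣ => a • u) ?_ ?_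
    · intro a _
      simp [huz, hu, Units.smul_def]
    · intro a _ b _ hab
      exact Units.ext (smul_left_injective F hu hab)
  have h1 := Finset.card_nsmul_le_sum _ _ _ hbad
  have h2 : ∑ z ∈ Finset.univ.filter (fun z => ∃ u, u ≠ 0 ∧ L u z = 0),
      (Finset.univ.filter fun u => u ≠ 0 ∧ L u z = 0).card ≤
      ∑ u ∈ Finset.univ.filter (fun u : U => u ≠ 0),
        (Finset.univ.filter fun z => L u z = 0).card := by
    refine (Finset.sum_le_sum_of_subset (Finset.subset_univ _)).trans_eq ?_
    simp only [Finset.card_filter, Finset.sum_filter, ite_and]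
    rw [Finset.sum_comm]
    refine Finset.sum_congr rfl fun u _ => ?_
    split_ifs <;> simp
  rw [Nat.card_eq_fintype_card (α := {z // ∃ u, u ≠ 0 ∧ L u z = 0}), Fintype.card_subtype]
  calc _ ≤ (∑ u ∈ Finset.univ.filter (fun u : U => u ≠ 0),
        (Finset.univ.filter fun z => L u z = 0).card) * Nat.card Y := by
        refine Nat.mul_le_mul_right _ (le_trans ?_ h2)
        rwa [smul_eq_mul, mul_comm] at h1
    _ = ∑ u ∈ Finset.univ.filter (fun u : U => u ≠ 0), Nat.card Z := by
        rw [Finset.sum_mul]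
        exact Finset.sum_congr rfl fun u hu => hker u (Finset.mem_filter.1 hu).2
    _ ≤ ∑ u : U, Nat.card Z := Finset.sum_le_sum_of_subset (Finset.subset_univ _)
    _ = _ := by simp

end UnionBound

/-! ### Failure probabilities of the three random events. -/

section Bounds

variable {F K : Type*} [Field F] [Field K] [Algebra F K] [Finite F] [Finite K]

/-- Union bound over coefficient vectors in `W^r`: there are at most `|K|` of them, and a nonzero
one annihilates a fraction `1/|K|` of the families `e`. -/
theorem card_not_independentOver_le {r : ℕ} (W : Submodule F K)
    (h : Module.finrank F W * r ≤ Module.finrank F K) :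
    (Nat.card F - 1) * Nat.card {e : Fin r → K // ¬ IndependentOver W e} ≤
      Nat.card (Fin r → K) := by
  have hW : Finite W := inferInstance
  let L : (Fin r → W) →ₗ[F] (Fin r → K) →ₗ[F] K := LinearMap.mk₂ F (fun w e => combination W e w)
    (fun w w' e => by simp) (fun a w e => by simp)
    (fun w e e' => by simp [combination_apply, mul_add, Finset.sum_add_distrib])
    (fun a w e => by simp [combination_apply, Finset.smul_sum])
  have key := card_exists_eq_zero_le L (by
    intro w hw y
    obtain ⟨b, hb⟩ := Function.ne_iff.1 hw
    have hb' : (w b : K) ≠ 0 := fun h0 => hb (Subtype.ext h0)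
    refine ⟨Pi.single b ((w b : K)⁻¹ * y), ?_⟩
    simp only [L, LinearMap.mk₂_apply, combination_apply]
    rw [Finset.sum_eq_single b (fun b' _ hne => by simp [hne]) (by simp), Pi.single_eq_same,
      mul_inv_cancel_left₀ hb'])
  have hset : Nat.card {e : Fin r → K // ¬ IndependentOver W e} =
      Nat.card {e // ∃ w, w ≠ 0 ∧ L w e = 0} := by
    refine Nat.card_congr (Equiv.subtypeEquivRight fun e => ?_)
    simp only [IndependentOver, L]
    push Not
    exact ⟨fun ⟨w, h1, h2⟩ => ⟨w, h2, h1⟩, fun ⟨w, h1, h2⟩ => ⟨w, h2, h1⟩⟩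
  rw [hset]
  refine Nat.le_of_mul_le_mul_right (key.trans ?_) (Nat.card_pos (α := K))
  rw [mul_comm]
  refine Nat.mul_le_mul_left _ ?_
  rw [Module.natCard_eq_pow_finrank (K := F) (V := K),
    Module.natCard_eq_pow_finrank (K := F) (V := Fin r → W), Module.finrank_pi_fintype]
  refine Nat.pow_le_pow_right Nat.card_pos ?_
  simpa [mul_comm] using h

/-- The union is over the `q^t` possible relations, each nonzero one holding for a fraction `q^(-r)`
of the matrices. -/
theorem card_not_linearIndependent_le (t r : ℕ) :
    (Nat.card F - 1) * Nat.card {X : Fin t → Fin r → F // ¬ LinearIndependent F X} *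
      Nat.card F ^ r ≤ Nat.card F ^ t * Nat.card (Fin t → Fin r → F) := by
  let L : (Fin t → F) →ₗ[F] (Fin t → Fin r → F) →ₗ[F] (Fin r → F) :=
    LinearMap.mk₂ F (fun a X => ∑ j, a j • X j)
      (fun w w' e => by simp [add_smul, Finset.sum_add_distrib])
      (fun a w e => by simp [Finset.smul_sum, mul_smul])
      (fun w e e' => by simp [Finset.sum_add_distrib])
      (fun a w e => by simp [Finset.smul_sum, smul_comm a])
  have key := card_exists_eq_zero_le L (by
    intro a ha y
    obtain ⟨j, hj⟩ := Function.ne_iff.1 ha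
    refine ⟨Pi.single j ((a j)⁻¹ • y), ?_⟩
    simp only [L, LinearMap.mk₂_apply]
    rw [Finset.sum_eq_single j (fun b' _ hne => by simp [hne]) (by simp), Pi.single_eq_same,
      smul_inv_smul₀ hj])
  have hset : Nat.card {X : Fin t → Fin r → F // ¬ LinearIndependent F X} =
      Nat.card {X // ∃ a, a ≠ 0 ∧ L a X = 0} := by
    refine Nat.card_congr (Equiv.subtypeEquivRight fun X => ?_)
    rw [Fintype.not_linearIndependent_iff]
    simp only [L, LinearMap.mk₂_apply, Function.ne_iff]
    exact ⟨fun ⟨w, h1, h2⟩ => ⟨w, h2, h1⟩, fun ⟨w, h1, h2⟩ => ⟨w, h2, h1⟩⟩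
  rw [hset]
  simpa [Nat.card_fun] using key

/-- If generation fails, a nonzero linear form vanishes on `T` and on all `Y i`. The union is over
the annihilator of `T`, and a nonzero form kills `c` random vectors with probability `q^(-c)`. -/
theorem card_not_generating_le {M : Type*} [AddCommGroup M] [Module F M] [Finite M] (c : ℕ)
    (T : Submodule F M) :
    (Nat.card F - 1) *
        Nat.card {Y : Fin c → M // ¬ Submodule.span F (Set.range Y) ⊔ T = ⊤} * Nat.card F ^ c ≤
      Nat.card F ^ (Module.finrank F M - Module.finrank F T) * Nat.card (Fin c → M) := by
  have : Finite (Module.Dual F M) := Module.finite_of_finite F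
  let L : T.dualAnnihilator →ₗ[F] (Fin c → M) →ₗ[F] (Fin c → F) :=
    LinearMap.mk₂ F (fun φ Y i => (φ : Module.Dual F M) (Y i))
      (fun w w' e => by ext; simp) (fun a w e => by ext; simp)
      (fun w e e' => by ext; simp) (fun a w e => by ext; simp)
  have hL : ∀ φ, φ ≠ 0 → Function.Surjective (L φ) := by
    intro φ hφ y
    have h0 : (φ : Module.Dual F M) ≠ 0 := fun h => hφ (Subtype.ext h)
    choose Y hY using fun i => LinearMap.surjective_iff_ne_zero.2 h0 (y i)
    exact ⟨Y, funext hY⟩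
  have key := card_exists_eq_zero_le (F := F) (U := T.dualAnnihilator) (Z := Fin c → M)
    (Y := Fin c → F) L hL
  have hset : Nat.card {Y : Fin c → M // ¬ Submodule.span F (Set.range Y) ⊔ T = ⊤} ≤
      Nat.card {Y // ∃ φ, φ ≠ 0 ∧ L φ Y = 0} := by
    refine Nat.card_le_card_of_injective (Subtype.map id ?_)
      (Subtype.map_injective _ Function.injective_id)
    intro Y hY
    obtain ⟨f, hf0, hf⟩ := Submodule.exists_le_ker_of_lt_top _ (lt_top_iff_ne_top.2 hY)
    refine ⟨⟨f, ?_⟩, fun h => hf0 (congrArg Subtype.val h), ?_⟩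
    · rw [Submodule.mem_dualAnnihilator]
      exact fun m hm => hf (Submodule.mem_sup_right hm)
    · funext i
      exact hf (Submodule.mem_sup_left (Submodule.subset_span ⟨i, rfl⟩))
  have hdim : Nat.card T.dualAnnihilator =
      Nat.card F ^ (Module.finrank F M - Module.finrank F T) := by
    rw [Module.natCard_eq_pow_finrank (K := F) (V := T.dualAnnihilator)]
    congr 1
    have := Subspace.finrank_add_finrank_dualAnnihilator_eq T
    omega
  rw [← hdim]
  refine le_trans ?_ key
  rw [Nat.card_fun (α := Fin c) (β := F), Nat.card_fin]
  gcongr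

end Bounds

/-- The coordinates of the products of the basis of `V` with the erasures. -/
def erasureCoordinates {F : Type*} [Field F] {d t r : ℕ} (X : Fin t → Fin r → F) : Submodule F (Fin d × Fin r → F) :=
  Submodule.span F (Set.range fun (p : Fin d × Fin t) (ab : Fin d × Fin r) =>
    if ab.1 = p.1 then X p.2 ab.2 else 0)

/-- The generators with first index `a` are copies of the rows of `X` placed in block `a`, so
relations can be read off block by block. -/
theorem finrank_erasureCoordinates {F : Type*} [Field F] {d t r : ℕ} {X : Fin t → Fin r → F}
    (hX : LinearIndependent F X) :
    Module.finrank F (erasureCoordinates (d := d) X) = d * t := by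
  rw [erasureCoordinates, finrank_span_eq_card, Fintype.card_prod, Fintype.card_fin,
    Fintype.card_fin]
  rw [Fintype.linearIndependent_iff]
  rintro g hg ⟨a, j⟩
  refine Fintype.linearIndependent_iff.1 hX (fun j => g (a, j)) ?_ j
  funext b
  have h := congrFun hg (a, b)
  simpa [Finset.sum_apply, Fintype.sum_prod_type, Finset.sum_ite_eq] using h

/-- The third event depends on the second coordinate, but its conditional probability has a uniform
lower bound; hence success probabilities multiply. -/
theorem card_triples_ge {α β γ : Type*} [Finite α] [Finite β] [Finite γ] {A : α → Prop}
    {B : β → Prop} {C : β → γ → Prop} {a b g : ℝ} (hb : 0 ≤ b) (hg : 0 ≤ g)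
    (hA : a * Nat.card α ≤ Nat.card {x // A x}) (hB : b * Nat.card β ≤ Nat.card {x // B x})
    (hC : ∀ y, B y → g * Nat.card γ ≤ Nat.card {z // C y z}) :
    a * b * g * (Nat.card α * (Nat.card β * Nat.card γ)) ≤
      Nat.card {p : α × β × γ // A p.1 ∧ B p.2.1 ∧ C p.2.1 p.2.2} := by
  have := Fintype.ofFinite β
  have := Fintype.ofFinite {x // B x}
  have hinj : Nat.card ({x // A x} × Σ y : {x // B x}, {z // C y z}) ≤
      Nat.card {p : α × β × γ // A p.1 ∧ B p.2.1 ∧ C p.2.1 p.2.2} := by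
    refine Nat.card_le_card_of_injective
      (fun p => ⟨(p.1.1, p.2.1.1, p.2.2.1), p.1.2, p.2.1.2, p.2.2.2⟩) ?_
    rintro ⟨⟨x, hx⟩, ⟨y, hy⟩, ⟨z, hz⟩⟩ ⟨⟨x', hx'⟩, ⟨y', hy'⟩, ⟨z', hz'⟩⟩ h
    simp only [Subtype.mk.injEq, Prod.mk.injEq] at h
    obtain ⟨rfl, rfl, rfl⟩ := h
    rfl
  refine le_trans ?_ (Nat.cast_le.2 hinj)
  rw [Nat.card_prod, Nat.card_sigma]
  push_cast
  have h1 : g * Nat.card γ * Nat.card {x // B x} ≤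
      ∑ y : {x // B x}, (Nat.card {z // C y z} : ℝ) := by
    rw [Nat.card_eq_fintype_card (α := {x // B x}), ← Finset.card_univ, mul_comm, ← nsmul_eq_mul]
    exact Finset.card_nsmul_le_sum _ _ _ fun y _ => hC y y.2
  have h2 : g * Nat.card γ * (b * Nat.card β) ≤
      ∑ y : {x // B x}, (Nat.card {z // C y z} : ℝ) :=
    (mul_le_mul_of_nonneg_left hB (by positivity)).trans h1
  calc _ = (a * Nat.card α) * (g * Nat.card γ * (b * Nat.card β)) := by ring
    _ ≤ Nat.card {x // A x} * ∑ y : {x // B x}, (Nat.card {z // C y z} : ℝ) := by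
      gcongr

theorem card_good_ge {α : Type*} [Finite α] (A : α → Prop) {q : ℕ} (hq : 2 ≤ q) {u : ℝ}
    (h : (q - 1 : ℝ) * Nat.card {x // ¬ A x} ≤ u * Nat.card α) :
    (1 - u / (q - 1)) * Nat.card α ≤ Nat.card {x // A x} := by
  have hq' : (0 : ℝ) < q - 1 := by
    have : (2 : ℝ) ≤ q := by exact_mod_cast hq
    linarith
  have hs : (Nat.card {x // A x} : ℝ) + Nat.card {x // ¬ A x} = Nat.card α := by
    classical
    rw [← Nat.cast_add, ← Nat.card_sum, Nat.card_congr (Equiv.sumCompl A)]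
  have h2 : (Nat.card {x // ¬ A x} : ℝ) ≤ u / (q - 1) * Nat.card α := by
    rw [div_mul_eq_mul_div, le_div_iff₀ hq']
    linarith
  linarith

/-- Adding the three failure bounds in the second case would give `(2 + 1/q)/(q-1)`, which is too
much; the cross terms of the product make up for the excess. -/
theorem one_sub_two_div_le {q b g : ℝ} (hq : 3 < q) (hg : g = 0 ∧ b = 1 ∨ g = 1 ∧ b = 1 / q) :
    1 - 2 / (q - 1) ≤ (1 - 1 / (q - 1)) * (1 - b / (q - 1)) * (1 - g / (q - 1)) := by
  have h1 : (0 : ℝ) < q - 1 := by linarith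
  have h0 : (0 : ℝ) < q := by linarith
  rw [← sub_nonneg]
  rcases hg with ⟨rfl, rfl⟩ | ⟨rfl, rfl⟩
  · have : (1 - 1 / (q - 1)) * (1 - 1 / (q - 1)) * (1 - 0 / (q - 1)) - (1 - 2 / (q - 1)) =
        1 / (q - 1) ^ 2 := by field_simp; ring
    rw [this]
    positivity
  · have : (1 - 1 / (q - 1)) * (1 - 1 / q / (q - 1)) * (1 - 1 / (q - 1)) - (1 - 2 / (q - 1)) =
        (3 * q - 4) / (q * (q - 1) ^ 3) := by field_simp; ring
    rw [this]
    apply div_nonneg <;> [linarith; positivity]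

/-! ### Vectors with a given support -/

section Combine

variable {F K : Type*} [Field F] [Field K] [Algebra F K] {ι : Type*} {r : ℕ}

/-- The vector with coordinate matrix `p.2` in the family `p.1`. -/
def combine (p : (Fin r → K) × (ι → Fin r → F)) : ι → K := fun j => ∑ b, p.2 j b • p.1 b

theorem span_combine_le (p : (Fin r → K) × (ι → Fin r → F)) :
    Submodule.span F (Set.range (combine p)) ≤ Submodule.span F (Set.range p.1) := by
  rw [Submodule.span_le]
  rintro _ ⟨j, rfl⟩
  exact Submodule.sum_mem _ fun b _ => Submodule.smul_mem _ _ (Submodule.subset_span ⟨b, rfl⟩)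

/-- The number of bases of a space of dimension `r`. -/
def basesCount (q r : ℕ) : ℕ := ∏ i : Fin r, (q ^ r - q ^ (i : ℕ))

theorem basesCount_pos {q r : ℕ} (hq : 2 ≤ q) : 0 < basesCount q r :=
  Finset.prod_pos fun i _ => Nat.sub_pos_of_lt (Nat.pow_lt_pow_right hq i.2)

/-- The `r` elements `p.1` span a space containing the support of `x`, which has dimension `r`. They
therefore form a basis of it, and the coordinate matrix `p.2` is then determined by `x`. -/
theorem card_combine_eq [Fintype F] [Finite K] [Finite ι] {x : ι → K} (hx : rankWeight F x = r) :
    Nat.card {p : (Fin r → K) × (ι → Fin r → F) // combine p = x} =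
      basesCount (Fintype.card F) r := by
  set S := Submodule.span F (Set.range x) with hS
  have hS' : Module.finrank F S = r := hx
  have hcard : Nat.card {s : Fin r → S // LinearIndependent F s} =
      basesCount (Fintype.card F) r := by
    rw [card_linearIndependent hS'.ge, hS']
    rfl
  rw [← hcard]
  have hle : ∀ p : {p : (Fin r → K) × (ι → Fin r → F) // combine p = x},
      S ≤ Submodule.span F (Set.range p.1.1) := by
    rintro ⟨p, rfl⟩
    exact span_combine_le p
  have hli : ∀ p : {p : (Fin r → K) × (ι → Fin r → F) // combine p = x},
      LinearIndependent F p.1.1 := by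
    intro p
    rw [linearIndependent_iff_card_le_finrank_span, Fintype.card_fin]
    exact hS'.ge.trans (Submodule.finrank_mono (hle p))
  have hsp : ∀ p : {p : (Fin r → K) × (ι → Fin r → F) // combine p = x},
      S = Submodule.span F (Set.range p.1.1) := by
    intro p
    apply Submodule.eq_of_le_of_finrank_eq (hle p)
    rw [hS', finrank_span_eq_card (hli p), Fintype.card_fin]
  refine Nat.card_eq_of_bijective (fun p => ⟨fun b => ⟨p.1.1 b, ?_⟩, ?_⟩) ⟨?_, ?_⟩
  · rw [hsp p]
    exact Submodule.subset_span ⟨b, rfl⟩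
  · exact LinearIndependent.of_comp S.subtype (hli p)
  · intro p p' h
    have he : p.1.1 = p'.1.1 := by
      funext b
      exact congrArg Subtype.val (congrFun (congrArg Subtype.val h) b)
    refine Subtype.ext (Prod.ext he ?_)
    funext j b
    have hj : ∑ b, p.1.2 j b • p.1.1 b = ∑ b, p'.1.2 j b • p.1.1 b := by
      have h1 := congrFun (p.2.trans p'.2.symm) j
      rw [combine, combine, ← he] at h1
      exact h1
    exact (hli p).eq_coords_of_eq hj b
  · rintro ⟨s, hs⟩
    have hs' : LinearIndependent F fun b => (s b : K) := hs.map' S.subtype (Submodule.ker_subtype S)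
    have hspan : Submodule.span F (Set.range fun b => (s b : K)) = S := by
      apply Submodule.eq_of_le_of_finrank_eq
      · rw [Submodule.span_le]
        rintro _ ⟨b, rfl⟩
        exact (s b).2
      · rw [hS', finrank_span_eq_card hs', Fintype.card_fin]
    have hX : ∀ j, ∃ a : Fin r → F, ∑ b, a b • (s b : K) = x j := fun j =>
      (Submodule.mem_span_range_iff_exists_fun F).1 (by
        rw [hspan]; exact Submodule.subset_span ⟨j, rfl⟩)
    choose X hX using hX
    exact ⟨⟨(fun b => (s b : K), X), funext hX⟩, rfl⟩

end Combine

/-! ### The proportion of signatures among random linear combinations. -/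

namespace SecretKey

section

variable {F K : Type*} [Field F] [Field K] [Algebra F K] {n c d t r : ℕ}
  (sk : SecretKey F K n c d t)

/-- The matrix `P X`. -/
def mask (X : Fin t ⊕ Fin n → Fin r → F) (i : Fin t ⊕ Fin n) (b : Fin r) : F :=
  ∑ j, sk.P i j * X j b

theorem mask_injective : Function.Injective (sk.mask : (_ → Fin r → F) → _) := by
  intro X X' h
  have hP := Matrix.mulVec_injective_of_isUnit sk.isUnit_P
  funext j b
  refine congrFun (hP (a₁ := fun j => X j b) (a₂ := fun j => X' j b) ?_) j
  funext i
  exact congrFun (congrFun h i) b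

theorem PK_mulVec_combine (e : Fin r → K) (X : Fin t ⊕ Fin n → Fin r → F) :
    sk.PK.mulVec (combine (e, X)) = combine (e, sk.mask X) := by
  funext i
  simp only [Matrix.mulVec, dotProduct, PK, Matrix.map_apply, combine, mask, Finset.mul_sum,
    Finset.sum_smul]
  rw [Finset.sum_comm]
  refine Finset.sum_congr rfl fun b _ => Finset.sum_congr rfl fun j _ => ?_
  rw [Algebra.smul_def, Algebra.smul_def, map_mul, mul_assoc]

/-- The coordinates of the erasures and of the syndrome. -/
def reduced (X : Fin t ⊕ Fin n → Fin r → F) :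
    (Fin t → Fin r → F) × (Fin c → Fin d × Fin r → F) :=
  (fun i => sk.mask X (Sum.inl i), sk.coordinates fun j => sk.mask X (Sum.inr j))

theorem reduced_injective : Function.Injective (sk.reduced (r := r)) := by
  intro X X' h
  apply sk.mask_injective
  have h1 := congrArg Prod.fst h
  have h2 := sk.coordinates_injective (congrArg Prod.snd h)
  funext i
  rcases i with i | j
  · exact congrFun h1 i
  · exact congrFun h2 j

/-- The linear map `Φ` from coordinates to `K` carries the generation condition in `F^(dr)` to the
one in `VE`. The rank of the combination needs no separate event: `VE` is contained in `V` times its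
support, so that support has dimension at least `r`. -/
theorem isSignature_combine [FiniteDimensional F K] {e : Fin r → K}
    {X : Fin t ⊕ Fin n → Fin r → F} (he : IndependentOver sk.sumSpace e)
    (hτ : LinearIndependent F (sk.reduced X).1)
    (hgen : Submodule.span F (Set.range (sk.reduced X).2) ⊔
      erasureCoordinates (sk.reduced X).1 = ⊤) :
    sk.IsSignature r (combine (e, X)) := by
  have hd := sk.two_le
  have hE := sk.goodSupport_of_independentOver he
  have hli : LinearIndependent F e := by
    rw [linearIndependent_iff_card_eq_finrank_span, Fintype.card_fin]
    exact hE.1.symm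
  have hτe : (fun i => sk.PK.mulVec (combine (e, X)) (Sum.inl i)) =
      fun i => Fintype.linearCombination F e ((sk.reduced X).1 i) := by
    funext i
    rw [PK_mulVec_combine]
    rfl
  have hxe : (fun j => sk.PK.mulVec (combine (e, X)) (Sum.inr j)) =
      fun j => ∑ b, sk.mask X (Sum.inr j) b • e b := by
    funext i
    rw [PK_mulVec_combine]
    rfl
  set Φ := Fintype.linearCombination F fun p : Fin d × Fin r => sk.basis p.1 * e p.2 with hΦ
  have h1 : Submodule.map Φ ⊤ = sk.space * Submodule.span F (Set.range e) := by
    rw [Submodule.map_top, hΦ, Fintype.range_linearCombination, span_products]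
    rfl
  have h2 : Submodule.map Φ (Submodule.span F (Set.range (sk.reduced X).2)) =
      Submodule.span F (Set.range (sk.H.mulVec
        fun j => sk.PK.mulVec (combine (e, X)) (Sum.inr j))) := by
    rw [Submodule.map_span, ← Set.range_comp]
    congr 2
    funext i
    rw [hxe, H_mulVec]
    rfl
  have h3 : Submodule.map Φ (erasureCoordinates (sk.reduced X).1) =
      sk.space * Submodule.span F
        (Set.range fun i => sk.PK.mulVec (combine (e, X)) (Sum.inl i)) := by
    rw [erasureCoordinates, Submodule.map_span, ← Set.range_comp, space, ← span_products]
    congr 2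
    funext p
    rw [congrFun hτe p.2]
    simp [hΦ, Fintype.linearCombination_apply, Fintype.sum_prod_type, Finset.mul_sum]
  have hgen' := congrArg (Submodule.map Φ) hgen
  rw [Submodule.map_sup, h1, h2, h3] at hgen'
  refine ⟨⟨?_, ?_⟩, ?_⟩
  · rw [hτe]
    exact hτ.map' _ (LinearMap.ker_eq_bot.2 hli.fintypeLinearCombination_injective)
  · exact sk.tDecodable_iff.2 ⟨_, hE, hgen'⟩
  · apply le_antisymm
    · exact (Submodule.finrank_mono (span_combine_le (e, X))).trans hE.1.le
    · have hle := sk.span_syndrome_le (sk.PK.mulVec (combine (e, X)))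
      rw [hgen', span_PK_mulVec] at hle
      have h4 := (Submodule.finrank_mono hle).trans (finrank_mul_le _ _)
      rw [hE.2.1, finrank_space] at h4
      exact Nat.le_of_mul_le_mul_left h4 (by omega)

end

section

variable {F K : Type*} [Field F] [Field K] [Fintype K] [Algebra F K] {n c d t : ℕ}
  (sk : SecretKey F K n c d t)

open Classical in
/-- The set of the vectors that occur as genuine signatures. -/
def signatures (r : ℕ) : Finset (Fin t ⊕ Fin n → K) :=
  Finset.univ.filter (sk.IsSignature r)

theorem mem_signatures {r : ℕ} {x : Fin t ⊕ Fin n → K} :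
    x ∈ sk.signatures r ↔ sk.IsSignature r x := by
  simp [signatures]

/-- Random linear combinations `X e` of random elements are signatures with high probability. -/
theorem le_card_signatures [Fintype F] {r' : ℕ} (hn : n = c * d) (hr' : r' * d ≤ c)
    (hm : (t + r') * (2 * d - 1) ≤ Module.finrank F K) :
    (1 - 2 / ((Fintype.card F : ℝ) - 1)) *
        Nat.card ((Fin (t + r') → K) × (Fin t ⊕ Fin n → Fin (t + r') → F)) ≤
      (sk.signatures (t + r')).card * basesCount (Fintype.card F) (t + r') := by
  classical
  set q := Fintype.card F with hqF
  have hNq : Nat.card F = q := Nat.card_eq_fintype_card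
  have hq2 : 2 ≤ q := Fintype.one_lt_card
  -- For `q ≤ 3` the left side is not positive.
  by_cases hq : q ≤ 3
  · refine le_trans (mul_nonpos_of_nonpos_of_nonneg ?_ (Nat.cast_nonneg _)) (by positivity)
    have h2 : (2 : ℝ) ≤ q := by exact_mod_cast hq2
    have h3 : (q : ℝ) ≤ 3 := by exact_mod_cast hq
    rw [sub_nonpos, le_div_iff₀ (by linarith)]
    linarith
  push Not at hq
  have hqR : (3 : ℝ) < q := by exact_mod_cast hq
  have hq1 : (0 : ℝ) < q - 1 := by linarith
  have hcast : ((q - 1 : ℕ) : ℝ) = (q : ℝ) - 1 := by rw [Nat.cast_sub (by omega)]; simp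
  set r := t + r' with hr
  let A : (Fin r → K) → Prop := fun e => IndependentOver sk.sumSpace e
  let B : (Fin t → Fin r → F) → Prop := fun X => LinearIndependent F X
  let C : (Fin t → Fin r → F) → (Fin c → Fin d × Fin r → F) → Prop := fun X Y =>
    Submodule.span F (Set.range Y) ⊔ erasureCoordinates X = ⊤
  -- the three events
  have hA : (1 - 1 / ((q : ℝ) - 1)) * Nat.card (Fin r → K) ≤ Nat.card {e // A e} := by
    apply card_good_ge A hq2
    have h := card_not_independentOver_le (r := r) sk.sumSpace (by
      rw [finrank_sumSpace, mul_comm]; exact hm)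
    rw [hNq] at h
    rw [one_mul, ← hcast]
    exact_mod_cast h
  have hB : (q - 1) * Nat.card {X // ¬ B X} * q ^ r' ≤ Nat.card (Fin t → Fin r → F) := by
    have h := card_not_linearIndependent_le (F := F) t r
    rw [hNq, hr, pow_add, mul_comm (q ^ t), ← mul_assoc] at h
    rw [mul_comm (q ^ t)] at h
    exact Nat.le_of_mul_le_mul_right h (by positivity)
  -- The erasures have dimension `dt` in `F^(dr)`, leaving codimension `dr'`.
  have hC : ∀ X, B X → (q - 1) * Nat.card {Y // ¬ C X Y} * q ^ c ≤
      q ^ (d * r') * Nat.card (Fin c → Fin d × Fin r → F) := by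
    intro X hX
    have h := card_not_generating_le (F := F) c (erasureCoordinates (d := d) X)
    rw [hNq, finrank_erasureCoordinates hX, Module.finrank_fintype_fun_eq_card,
      Fintype.card_prod, Fintype.card_fin, Fintype.card_fin, ← Nat.mul_sub,
      show r - t = r' by omega] at h
    exact h
  -- Here `b/(q-1)` and `g/(q-1)` bound the failures of `B` and `C`. For `r' = 0` the erasures alone
  -- generate everything, so `g = 0`; for `r' > 0` the `t` erasures live in dimension at least `t +
  -- 1`, which gains a factor `1/q`.
  obtain ⟨b, g, hbg, hb, hg⟩ : ∃ b g : ℝ, (g = 0 ∧ b = 1 ∨ g = 1 ∧ b = 1 / q) ∧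
      (1 - b / ((q : ℝ) - 1)) * Nat.card (Fin t → Fin r → F) ≤ Nat.card {X // B X} ∧
      ∀ X, B X → (1 - g / ((q : ℝ) - 1)) * Nat.card (Fin c → Fin d × Fin r → F) ≤
        Nat.card {Y // C X Y} := by
    rcases Nat.eq_zero_or_pos r' with h0 | hpos
    · refine ⟨1, 0, Or.inl ⟨rfl, rfl⟩, ?_, ?_⟩
      · apply card_good_ge B hq2
        rw [one_mul, ← hcast]
        rw [h0, pow_zero, mul_one] at hB
        exact_mod_cast hB
      · intro X hX
        have hT : erasureCoordinates (d := d) X = ⊤ := by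
          apply Submodule.eq_top_of_finrank_eq
          rw [finrank_erasureCoordinates hX, Module.finrank_fintype_fun_eq_card,
            Fintype.card_prod, Fintype.card_fin, Fintype.card_fin, hr, h0, add_zero]
        have hall : ∀ Y, C X Y := fun Y => by simp only [C, hT, sup_top_eq]
        rw [zero_div, sub_zero, one_mul, Nat.card_congr (Equiv.subtypeUnivEquiv hall)]
    · refine ⟨1 / q, 1, Or.inr ⟨rfl, rfl⟩, ?_, ?_⟩
      · apply card_good_ge B hq2
        have h1 : (q - 1) * Nat.card {X // ¬ B X} * q ≤ Nat.card (Fin t → Fin r → F) :=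
          (Nat.mul_le_mul_left _ (Nat.le_self_pow hpos.ne' q)).trans hB
        rw [one_div, inv_mul_eq_div, le_div_iff₀ (by linarith), ← hcast]
        exact_mod_cast h1
      · intro X hX
        apply card_good_ge (C X) hq2
        have h1 : (q - 1) * Nat.card {Y // ¬ C X Y} ≤ Nat.card (Fin c → Fin d × Fin r → F) := by
          refine Nat.le_of_mul_le_mul_right ((hC X hX).trans ?_) (pow_pos (by omega) c : 0 < q ^ c)
          rw [mul_comm]
          refine Nat.mul_le_mul_left _ (Nat.pow_le_pow_right (by omega) ?_)
          rw [mul_comm]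
          exact hr'
        rw [one_mul, ← hcast]
        exact_mod_cast h1
  have hb0 : 0 ≤ 1 - b / ((q : ℝ) - 1) := by
    have hb1 : b ≤ 1 := by
      rcases hbg with ⟨-, rfl⟩ | ⟨-, rfl⟩
      · exact le_rfl
      · rw [div_le_one (by linarith)]; linarith
    rw [sub_nonneg, div_le_one hq1]
    linarith
  have hg0 : 0 ≤ 1 - g / ((q : ℝ) - 1) := by
    have hg1 : g ≤ 1 := by
      rcases hbg with ⟨rfl, -⟩ | ⟨rfl, -⟩ <;> norm_num
    rw [sub_nonneg, div_le_one hq1]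
    linarith
  have hprod := card_triples_ge hb0 hg0 hA hb hg
  -- Both sides have `(t + cd) r` coordinates over `F`, because `n = cd`.
  have hbij : Function.Bijective (sk.reduced (r := r)) := by
    rw [Fintype.bijective_iff_injective_and_card]
    refine ⟨sk.reduced_injective, ?_⟩
    simp only [Fintype.card_prod, Fintype.card_fun, Fintype.card_sum, Fintype.card_fin, ← pow_mul,
      ← pow_add]
    congr 1
    rw [hn]
    ring
  have hcardX : Nat.card (Fin t ⊕ Fin n → Fin r → F) =
      Nat.card (Fin t → Fin r → F) * Nat.card (Fin c → Fin d × Fin r → F) := by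
    rw [Nat.card_eq_of_bijective _ hbij, Nat.card_prod]
  have hgood : Nat.card {p : (Fin r → K) × (Fin t → Fin r → F) × (Fin c → Fin d × Fin r → F) //
      A p.1 ∧ B p.2.1 ∧ C p.2.1 p.2.2} ≤ (sk.signatures r).card * basesCount q r := by
    have h1 : Nat.card {p : (Fin r → K) × (Fin t → Fin r → F) ×
        (Fin c → Fin d × Fin r → F) // A p.1 ∧ B p.2.1 ∧ C p.2.1 p.2.2} ≤
        (Finset.univ.filter fun p : (Fin r → K) × (Fin t ⊕ Fin n → Fin r → F) =>
          combine p ∈ sk.signatures r).card := by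
      rw [← Fintype.card_subtype, ← Nat.card_eq_fintype_card]
      choose inv hinv using hbij.2
      refine Nat.card_le_card_of_injective (fun p => ⟨(p.1.1, inv p.1.2), ?_⟩) ?_
      · obtain ⟨⟨e, Z⟩, h1, h2, h3⟩ := p
        rw [mem_signatures]
        apply sk.isSignature_combine h1 <;> rw [hinv]
        · exact h2
        · exact h3
      · intro p p' h
        have h' := congrArg Subtype.val h
        refine Subtype.ext (Prod.ext (congrArg Prod.fst h' :) ?_)
        rw [← hinv p.1.2, ← hinv p'.1.2]
        exact congrArg sk.reduced (congrArg Prod.snd h')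
    refine h1.trans ?_
    rw [mul_comm]
    apply Finset.card_le_mul_card_image_of_maps_to (f := combine)
    · intro p hp
      exact (Finset.mem_filter.1 hp).2
    · intro x hx
      rw [mem_signatures] at hx
      rw [← card_combine_eq hx.2, Nat.card_eq_fintype_card, Fintype.card_subtype]
      apply Finset.card_le_card
      intro p hp
      simp only [Finset.mem_filter, Finset.mem_univ, true_and] at hp ⊢
      exact hp.2
  rw [Nat.card_prod, hcardX]
  push_cast
  calc _ ≤ (1 - 1 / ((q : ℝ) - 1)) * (1 - b / (q - 1)) * (1 - g / (q - 1)) * _ :=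
        mul_le_mul_of_nonneg_right (one_sub_two_div_le hqR hbg) (by positivity)
    _ ≤ _ := hprod
    _ ≤ _ := by exact_mod_cast hgood

end

end SecretKey

/-! ### Laws of genuine and simulated pairs. -/

namespace SecretKey

variable {F K : Type*} [Field F] [Field K] [Fintype K] [Algebra F K] {n c d t : ℕ}
  (sk : SecretKey F K n c d t)

open Classical in
-- Exactly one choice of `τ` can lead to `x`, namely the first block of `Px`. The value does not
-- depend on `x`, which is the source of uniformity.
theorem attempt_some (r : ℕ) (s : Fin c → K) (x : Fin t ⊕ Fin n → K) :
    sk.attempt r s (some x) =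
      if x ∈ sk.signatures r ∧ sk.publicKey.mulVec x = s then
        ((independentTuples F K t).card : ℝ≥0∞)⁻¹ else 0 := by
  have hmem : ∀ τ, τ ∈ independentTuples F K t ↔ LinearIndependent F τ := by
    simp [independentTuples]
  by_cases hne : (independentTuples F K t).Nonempty
  · rw [attempt, uniformOn, dif_pos hne, PMF.map_comp, PMF.map_apply]
    refine (tsum_congr fun τ => ?_).trans (tsum_ite_eq (fun i => sk.PK.mulVec x (Sum.inl i))
      fun _ => if x ∈ sk.signatures r ∧ sk.publicKey.mulVec x = s then
        ((independentTuples F K t).card : ℝ≥0∞)⁻¹ else 0)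
    rw [PMF.uniformOfFinset_apply]
    simp only [Function.comp_apply, Option.bind_some, hmem, mem_signatures]
    by_cases hτ : LinearIndependent F τ
    · have h := eq_comm.trans (sk.signatureOf_eq_some_iff (r := r) (s := s) hτ (x := x))
      simp only [h]
      split_ifs <;> tauto
    · have : (τ = fun i => sk.PK.mulVec x (Sum.inl i)) →
          ¬ (sk.IsSignature r x ∧ sk.publicKey.mulVec x = s) := by
        rintro rfl ⟨h, -⟩
        exact hτ h.1.1
      split_ifs <;> tauto
  · rw [attempt, uniformOn, dif_neg hne, PMF.pure_map, PMF.pure_apply,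
      if_neg (by simp), if_neg]
    rintro ⟨h, -⟩
    exact hne ⟨_, (hmem _).2 ((sk.mem_signatures).1 h).1.1⟩

theorem freshAttempt_none (r : ℕ) :
    sk.freshAttempt r none =
      ∑ s : Fin c → K, (Fintype.card (Fin c → K) : ℝ≥0∞)⁻¹ * sk.attempt r s none := by
  classical
  rw [freshAttempt, PMF.bind_apply, tsum_fintype]
  refine Finset.sum_congr rfl fun s _ => ?_
  rw [PMF.uniformOfFintype_apply, PMF.map_apply, tsum_eq_single none]
  · simp
  · rintro (_ | x) h
    · exact absurd rfl h
    · simp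

open Classical in
theorem freshAttempt_some (r : ℕ) (x : Fin t ⊕ Fin n → K) (s : Fin c → K) :
    sk.freshAttempt r (some (x, s)) =
      if x ∈ sk.signatures r ∧ sk.publicKey.mulVec x = s then
        (Fintype.card (Fin c → K) : ℝ≥0∞)⁻¹ *
          ((independentTuples F K t).card : ℝ≥0∞)⁻¹ else 0 := by
  rw [freshAttempt, PMF.bind_apply, tsum_fintype, Finset.sum_eq_single s _ (by simp)]
  · rw [PMF.uniformOfFintype_apply, PMF.map_apply, tsum_eq_single (some x)]
    · rw [attempt_some]
      simp
    · rintro (_ | x') h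
      · simp
      · rw [if_neg]
        intro h'
        exact h (by simpa using h'.symm)
  · intro s' _ hs
    rw [PMF.map_apply, ENNReal.tsum_eq_zero.2, mul_zero]
    rintro (_ | x')
    · simp
    · rw [if_neg]
      intro h'
      have := Option.some.inj h'
      exact hs (congrArg Prod.snd this).symm

open Classical in
-- One fresh attempt yields each signature with the same probability `a`, so it succeeds with
-- probability `a` times the number of signatures; the geometric series over failed attempts divides
-- by this number.
theorem genuineLaw_apply (r : ℕ) (x : Fin t ⊕ Fin n → K) (s : Fin c → K) :
    sk.genuineLaw r (x, s) =
      if x ∈ sk.signatures r ∧ sk.publicKey.mulVec x = s then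
        ((sk.signatures r).card : ℝ≥0∞)⁻¹ else 0 := by
  set a : ℝ≥0∞ := (Fintype.card (Fin c → K) : ℝ≥0∞)⁻¹ *
    ((independentTuples F K t).card : ℝ≥0∞)⁻¹ with ha
  have hsum := (sk.freshAttempt r).tsum_coe
  rw [tsum_fintype, Fintype.sum_option, Fintype.sum_prod_type] at hsum
  simp only [freshAttempt_some, ite_and, Finset.sum_ite_irrel, Finset.sum_ite_eq,
    Finset.mem_univ, if_true, Finset.sum_const_zero] at hsum
  rw [Finset.sum_ite_mem, Finset.univ_inter, Finset.sum_const, nsmul_eq_mul, ← ha] at hsum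
  have hnone : sk.freshAttempt r none ≠ ⊤ := PMF.apply_ne_top _ _
  have hsub : 1 - sk.freshAttempt r none = (sk.signatures r).card * a := by
    rw [← hsum]
    exact ENNReal.add_sub_cancel_left hnone
  rw [genuineLaw, ENNReal.tsum_mul_right, ENNReal.tsum_geometric, hsub, freshAttempt_some, ← ha]
  split_ifs with h
  · have hτ : (independentTuples F K t).card ≠ 0 := by
      refine Finset.card_ne_zero_of_mem (a := fun i => sk.PK.mulVec x (Sum.inl i)) ?_
      simpa [independentTuples] using ((sk.mem_signatures).1 h.1).1.1
    have ha0 : a ≠ 0 := mul_ne_zero (ENNReal.inv_ne_zero.2 (ENNReal.natCast_ne_top _))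
      (ENNReal.inv_ne_zero.2 (ENNReal.natCast_ne_top _))
    have hat : a ≠ ⊤ := ENNReal.mul_ne_top
      (ENNReal.inv_ne_top.2 (Nat.cast_ne_zero.2 Fintype.card_ne_zero))
      (ENNReal.inv_ne_top.2 (Nat.cast_ne_zero.2 hτ))
    rw [ENNReal.mul_inv (Or.inr hat) (Or.inr ha0), mul_assoc, ENNReal.inv_mul_cancel ha0 hat,
      mul_one]
  · rw [mul_zero]

/-- A sum of powers of the failure probability is bounded by the genuine law. -/
theorem sum_pow_mul_freshAttempt_le (r L : ℕ)
    (p : (Fin t ⊕ Fin n → K) × (Fin c → K)) :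
    (∑ j ∈ Finset.range L, sk.freshAttempt r none ^ j) * sk.freshAttempt r (some p) ≤
      sk.genuineLaw r p := by
  rw [genuineLaw, ENNReal.tsum_mul_right]
  gcongr
  exact ENNReal.sum_le_tsum _

theorem exists_rankWeight_eq (sk : SecretKey F K n c d t) {r' : ℕ} (hn : n = c * d) (hr' : r' * d ≤ c)
    (hm : (t + r') * (2 * d - 1) ≤ Module.finrank F K) :
    (rankVectors F K t n (t + r')).Nonempty := by
  have hd := sk.two_le
  have hr : t + r' ≤ Module.finrank F K :=
    (Nat.le_mul_of_pos_right _ (by omega)).trans hm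
  have hr'n : r' ≤ n := by
    rw [hn]
    exact (Nat.le_mul_of_pos_right r' (by omega)).trans
      (hr'.trans (Nat.le_mul_of_pos_right c (by omega)))
  let e : Fin (t + r') → K := Module.finBasis F K ∘ Fin.castLE hr
  have he : LinearIndependent F e :=
    (Module.finBasis F K).linearIndependent.comp _ (Fin.castLE_injective hr)
  let j : Fin (t + r') → Fin t ⊕ Fin n := Sum.map id (Fin.castLE hr'n) ∘ finSumFinEquiv.symm
  have hj : Function.Injective j :=
    (Sum.map_injective.2 ⟨Function.injective_id, Fin.castLE_injective hr'n⟩).comp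
      finSumFinEquiv.symm.injective
  -- Place `t + r'` independent elements at distinct positions and zeros elsewhere. There is room
  -- since `r' ≤ r'd ≤ c ≤ n`.
  refine ⟨Function.extend j e 0, ?_⟩
  rw [rankVectors, Finset.mem_filter, rankWeight]
  refine ⟨Finset.mem_univ _, ?_⟩
  have hspan : Submodule.span F (Set.range (Function.extend j e 0)) =
      Submodule.span F (Set.range e) := by
    apply le_antisymm
    · rw [Submodule.span_le]
      rintro _ ⟨i, rfl⟩
      by_cases hi : ∃ b, j b = i
      · obtain ⟨b, rfl⟩ := hi
        rw [hj.extend_apply]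
        exact Submodule.subset_span ⟨b, rfl⟩
      · rw [Function.extend_apply' _ _ _ hi]
        exact Submodule.zero_mem _
    · apply Submodule.span_mono
      rintro _ ⟨b, rfl⟩
      exact ⟨j b, hj.extend_apply _ _ _⟩
  rw [hspan, finrank_span_eq_card he, Fintype.card_fin]

theorem signatures_eq_filter [DecidablePred (sk.Decodable r)] :
    sk.signatures r = (rankVectors F K t n r).filter (sk.Decodable r) := by
  ext x
  simp [mem_signatures, IsSignature, rankVectors, and_comm]

open Classical in
theorem simulatedPair_apply {r : ℕ} (h : (rankVectors F K t n r).Nonempty)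
    (p : (Fin t ⊕ Fin n → K) × (Fin c → K)) :
    simulatedPair F sk.publicKey r h p =
      if p.1 ∈ rankVectors F K t n r ∧ sk.publicKey.mulVec p.1 = p.2 then
        ((rankVectors F K t n r).card : ℝ≥0∞)⁻¹ else 0 := by
  obtain ⟨x, y⟩ := p
  rw [simulatedPair, PMF.map_apply, tsum_eq_single x]
  · rw [PMF.uniformOfFinset_apply]
    simp only [Prod.mk.injEq, true_and]
    split_ifs <;> tauto
  · intro x' hx'
    rw [if_neg]
    intro h'
    exact hx' (congrArg Prod.fst h').symm

theorem toOuterMeasure_simulatedPair {r : ℕ} (h : (rankVectors F K t n r).Nonempty)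
    (P : (Fin t ⊕ Fin n → K) → Prop) [DecidablePred P] :
    (simulatedPair F sk.publicKey r h).toOuterMeasure {p | P p.1} =
      (((rankVectors F K t n r).filter P).card : ℝ≥0∞) / (rankVectors F K t n r).card := by
  rw [simulatedPair, PMF.toOuterMeasure_map_apply, PMF.toOuterMeasure_uniformOfFinset_apply]
  simp only [Set.mem_preimage, Set.mem_ofPred_eq]

theorem card_rankVectors_mul_le [Fintype F] (r : ℕ) :
    (rankVectors F K t n r).card * basesCount (Fintype.card F) r ≤
      Nat.card ((Fin r → K) × (Fin t ⊕ Fin n → Fin r → F)) := by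
  classical
  rw [Nat.card_eq_fintype_card]
  calc _ = ∑ x ∈ rankVectors F K t n r, basesCount (Fintype.card F) r := by
        rw [Finset.sum_const, smul_eq_mul]
    _ = ∑ x ∈ rankVectors F K t n r, ((Finset.univ :
          Finset ((Fin r → K) × (Fin t ⊕ Fin n → Fin r → F))).filter fun p =>
            combine p = x).card := by
        refine Finset.sum_congr rfl fun x hx => ?_
        rw [← card_combine_eq (F := F) (x := x) (by simpa [rankVectors] using hx),
          Nat.card_eq_fintype_card, Fintype.card_subtype]
    _ ≤ _ := by
        rw [← Finset.card_univ, Finset.card_eq_sum_card_fiberwise (f := combine)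
          (t := Finset.univ) fun _ _ => Finset.mem_coe.2 (Finset.mem_univ _)]
        exact Finset.sum_le_sum_of_subset (Finset.subset_univ _)

/-- The simulated pair is decodable with high probability. -/
theorem toOuterMeasure_not_decodable_le [Fintype F] {r' : ℕ} (hn : n = c * d) (hr' : r' * d ≤ c)
    (hm : (t + r') * (2 * d - 1) ≤ Module.finrank F K)
    (h : (rankVectors F K t n (t + r')).Nonempty) :
    (simulatedPair F sk.publicKey (t + r') h).toOuterMeasure {p | ¬ sk.Decodable (t + r') p.1} ≤
      ENNReal.ofReal (2 / ((Fintype.card F : ℝ) - 1)) := by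
  classical
  have hq2 : 2 ≤ Fintype.card F := Fintype.one_lt_card
  have hq2R : (2 : ℝ) ≤ Fintype.card F := by exact_mod_cast hq2
  have h1 := sk.le_card_signatures hn hr' hm
  have h2 : ((rankVectors F K t n (t + r')).card * basesCount (Fintype.card F) (t + r') : ℝ) ≤
      Nat.card ((Fin (t + r') → K) × (Fin t ⊕ Fin n → Fin (t + r') → F)) := by
    exact_mod_cast card_rankVectors_mul_le (F := F) (K := K) (t := t) (n := n) (t + r')
  have hg : (0 : ℝ) < basesCount (Fintype.card F) (t + r') := by
    exact_mod_cast basesCount_pos hq2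
  have h3 : ((rankVectors F K t n (t + r')).filter (sk.Decodable (t + r'))).card +
      ((rankVectors F K t n (t + r')).filter fun x => ¬ sk.Decodable (t + r') x).card =
      (rankVectors F K t n (t + r')).card := Finset.card_filter_add_card_filter_not _
  rw [← signatures_eq_filter] at h3
  have h3' : ((sk.signatures (t + r')).card : ℝ) +
      ((rankVectors F K t n (t + r')).filter fun x => ¬ sk.Decodable (t + r') x).card =
      (rankVectors F K t n (t + r')).card := by exact_mod_cast h3
  have hpos : (0 : ℝ) < (rankVectors F K t n (t + r')).card := by
    exact_mod_cast h.card_pos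
  have h4 : (1 - 2 / ((Fintype.card F : ℝ) - 1)) * (rankVectors F K t n (t + r')).card ≤
      (sk.signatures (t + r')).card := by
    rcases le_total (1 - 2 / ((Fintype.card F : ℝ) - 1)) 0 with h0 | h0
    · exact (mul_nonpos_of_nonpos_of_nonneg h0 hpos.le).trans (Nat.cast_nonneg _)
    · refine le_of_mul_le_mul_right ?_ hg
      rw [mul_assoc]
      exact (mul_le_mul_of_nonneg_left h2 h0).trans h1
  rw [sk.toOuterMeasure_simulatedPair h fun x => ¬ sk.Decodable (t + r') x]
  rw [← ENNReal.ofReal_natCast, ← ENNReal.ofReal_natCast, ← ENNReal.ofReal_div_of_pos hpos]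
  apply ENNReal.ofReal_le_ofReal
  rw [div_le_iff₀ hpos]
  linarith

/-- Conditionally on decodability, the simulated pair is distributed as a genuine one. -/
theorem simulatedPair_eq_mul_genuineLaw {r : ℕ} (h : (rankVectors F K t n r).Nonempty)
    (p : (Fin t ⊕ Fin n → K) × (Fin c → K)) (hp : sk.Decodable r p.1) :
    simulatedPair F sk.publicKey r h p =
      (simulatedPair F sk.publicKey r h).toOuterMeasure {p' | sk.Decodable r p'.1} *
        sk.genuineLaw r p := by
  classical
  obtain ⟨x, y⟩ := p
  have hmem : x ∈ rankVectors F K t n r ↔ x ∈ sk.signatures r := by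
    rw [signatures_eq_filter, Finset.mem_filter]
    exact ⟨fun h => ⟨h, hp⟩, fun h => h.1⟩
  rw [simulatedPair_apply, sk.toOuterMeasure_simulatedPair h (sk.Decodable r), genuineLaw_apply, ← signatures_eq_filter]
  simp only [hmem]
  split_ifs with hx
  · have h0 : ((sk.signatures r).card : ℝ≥0∞) ≠ 0 :=
      Nat.cast_ne_zero.2 (Finset.card_ne_zero_of_mem hx.1)
    rw [mul_comm, ← mul_div_assoc, ENNReal.inv_mul_cancel h0 (ENNReal.natCast_ne_top _), one_div]
  · rw [mul_zero]

theorem genuineLaw_eq_zero {r : ℕ} (p : (Fin t ⊕ Fin n → K) × (Fin c → K))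
    (hp : ¬ sk.Decodable r p.1) : sk.genuineLaw r p = 0 := by
  classical
  obtain ⟨x, y⟩ := p
  rw [genuineLaw_apply, if_neg]
  rintro ⟨h, -⟩
  exact hp (sk.mem_signatures.1 h).1

/-- The law of a random linear combination `X e` of random elements dominates the law of genuine
signatures up to the factor `1 - 2 / (q - 1)`. -/
theorem sum_genuineLaw_le [Fintype F] {r' : ℕ} (hn : n = c * d) (hr' : r' * d ≤ c)
    (hm : (t + r') * (2 * d - 1) ≤ Module.finrank F K)
    (f : (Fin t ⊕ Fin n → K) → ℝ≥0∞) :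
    ENNReal.ofReal (1 - 2 / ((Fintype.card F : ℝ) - 1)) *
        ∑ x, sk.genuineLaw (t + r') (x, sk.publicKey.mulVec x) * f x ≤
      (Fintype.card ((Fin (t + r') → K) × (Fin t ⊕ Fin n → Fin (t + r') → F)) : ℝ≥0∞)⁻¹ *
        ∑ p : (Fin (t + r') → K) × (Fin t ⊕ Fin n → Fin (t + r') → F), f (combine p) := by
  classical
  set β := ENNReal.ofReal (1 - 2 / ((Fintype.card F : ℝ) - 1)) with hβ
  set M := Fintype.card ((Fin (t + r') → K) × (Fin t ⊕ Fin n → Fin (t + r') → F)) with hM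
  have hM0 : (M : ℝ≥0∞) ≠ 0 := Nat.cast_ne_zero.2 Fintype.card_ne_zero
  have hle : β * M ≤ (sk.signatures (t + r')).card * basesCount (Fintype.card F) (t + r') := by
    have h := ENNReal.ofReal_le_ofReal (sk.le_card_signatures hn hr' hm)
    rw [Nat.card_eq_fintype_card, ENNReal.ofReal_mul' (Nat.cast_nonneg _),
      ENNReal.ofReal_natCast, ENNReal.ofReal_mul (Nat.cast_nonneg _), ENNReal.ofReal_natCast,
      ENNReal.ofReal_natCast] at h
    exact h
  -- On each signature, compare its genuine probability with the probability that a random pair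
  -- combines to it, which is `basesCount` over `M`.
  have hpoint : ∀ x ∈ sk.signatures (t + r'),
      β * ((sk.signatures (t + r')).card : ℝ≥0∞)⁻¹ ≤
        (M : ℝ≥0∞)⁻¹ * basesCount (Fintype.card F) (t + r') := by
    intro x hx
    have h0 : ((sk.signatures (t + r')).card : ℝ≥0∞) ≠ 0 :=
      Nat.cast_ne_zero.2 (Finset.card_ne_zero_of_mem hx)
    rw [← div_eq_mul_inv, ENNReal.div_le_iff h0 (ENNReal.natCast_ne_top _), mul_assoc,
      mul_comm _⁻¹, ← div_eq_mul_inv, ENNReal.le_div_iff_mul_le (Or.inl hM0)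
      (Or.inl (ENNReal.natCast_ne_top _)), mul_comm (basesCount _ _ : ℝ≥0∞)]
    exact hle
  calc _ = ∑ x ∈ sk.signatures (t + r'),
        β * ((sk.signatures (t + r')).card : ℝ≥0∞)⁻¹ * f x := by
        rw [Finset.mul_sum]
        simp only [genuineLaw_apply, and_true, ite_mul, zero_mul, mul_ite, mul_zero, mul_assoc]
        rw [Finset.sum_ite_mem, Finset.univ_inter]
    _ ≤ ∑ x ∈ sk.signatures (t + r'),
        (M : ℝ≥0∞)⁻¹ * basesCount (Fintype.card F) (t + r') * f x :=
        Finset.sum_le_sum fun x hx => mul_le_mul' (hpoint x hx) le_rfl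
    _ = (M : ℝ≥0∞)⁻¹ * ∑ x ∈ sk.signatures (t + r'), ∑ p ∈ (Finset.univ :
          Finset ((Fin (t + r') → K) × (Fin t ⊕ Fin n → Fin (t + r') → F))).filter
            (fun p => combine p = x), f (combine p) := by
        rw [Finset.mul_sum]
        refine Finset.sum_congr rfl fun x hx => ?_
        rw [mul_assoc]
        congr 1
        rw [Finset.sum_congr rfl (g := fun _ => f x) fun p hp => by
          rw [(Finset.mem_filter.1 hp).2], Finset.sum_const, nsmul_eq_mul,
          ← card_combine_eq (sk.mem_signatures.1 hx).2, Nat.card_eq_fintype_card,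
          Fintype.card_subtype]
    -- Pairs that do not combine to a signature only add nonnegative terms, so the simulation need
    -- not discard them.
    _ ≤ _ := by
        gcongr
        rw [← Finset.sum_fiberwise Finset.univ combine]
        exact Finset.sum_le_sum_of_subset (Finset.subset_univ _)

end SecretKey

/-! ### Simulation of the signer -/

section Programs

variable {K : Type*} {n c t l : ℕ}

/-- The operand is defined as soon as the memory has the given length. -/
def Operand.Bounded (len : ℕ) : Operand n c t → Prop
  | .key _ _ => True
  | .reg a => a < len

theorem Operand.Bounded.mono {len len' : ℕ} {u : Operand n c t} (h : u.Bounded len)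
    (hle : len ≤ len') : u.Bounded len' := by
  cases u with
  | key => trivial
  | reg a => exact lt_of_lt_of_le h hle

theorem Operand.eval_append [Field K] {H' : Matrix (Fin c) (Fin t ⊕ Fin n) K} {mem : List K}
    {u : Operand n c t} (h : u.Bounded mem.length) (suf : List K) :
    u.eval H' (mem ++ suf) = u.eval H' mem := by
  cases u with
  | key => rfl
  | reg a => exact List.getD_append _ _ _ _ h

theorem Operand.eval_reg_append_ofFn [Field K] {H' : Matrix (Fin c) (Fin t ⊕ Fin n) K}
    (mem : List K) {k : ℕ} (y : Fin k → K) (suf : List K) (i : Fin k) :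
    (Operand.reg (mem.length + i) : Operand n c t).eval H' (mem ++ List.ofFn y ++ suf) = y i := by
  have hi : mem.length + (i : ℕ) < (mem ++ List.ofFn y).length := by simp
  rw [Operand.eval_append (u := .reg _) hi]
  simp [Operand.eval, List.getD_eq_getElem?_getD]

/-- The operand after a change of addresses. -/
def Operand.rename (len : ℕ) (ρ : List (Operand n c t)) : Operand n c t → Operand n c t
  | .key i j => .key i j
  -- An unwritten address must still read as `0`; with memory of length `len`, register `len` is
  -- unwritten.
  | .reg a => ρ.getD a (.reg len)

theorem Operand.eval_rename [Field K] (H' : Matrix (Fin c) (Fin t ⊕ Fin n) K) (mem : List K)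
    (ρ : List (Operand n c t)) (u : Operand n c t) :
    (u.rename mem.length ρ).eval H' mem = u.eval H' (ρ.map (Operand.eval H' mem)) := by
  cases u with
  | key => rfl
  | reg a =>
    simp only [Operand.rename, List.getD_eq_getElem?_getD]
    cases h : ρ[a]? with
    | none => simp [Operand.eval, h]
    | some v => rw [Operand.eval.eq_def H' (List.map _ _)]; simp [h]

/-- The instruction after a change of addresses. -/
def Arith.rename (len : ℕ) (ρ : List (Operand n c t)) : Arith K n c t → Arith K n c t
  | .const a => .const a
  | .add u v => .add (u.rename len ρ) (v.rename len ρ)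
  | .sub u v => .sub (u.rename len ρ) (v.rename len ρ)
  | .mul u v => .mul (u.rename len ρ) (v.rename len ρ)
  | .inv u => .inv (u.rename len ρ)

theorem Arith.eval_rename [Field K] (H' : Matrix (Fin c) (Fin t ⊕ Fin n) K) (mem : List K)
    (ρ : List (Operand n c t)) (op : Arith K n c t) :
    (op.rename mem.length ρ).eval H' mem = op.eval H' (ρ.map (Operand.eval H' mem)) := by
  cases op <;> simp [Arith.rename, Arith.eval, Operand.eval_rename]

namespace Algorithm

/-- Append `k` random elements of the large field to the memory. -/
def randLarges : ℕ → Algorithm K n c t l → Algorithm K n c t l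
  | 0, next => next
  | k + 1, next => randLarge (randLarges k next)

/-- Append `k` random elements of the small field to the memory. -/
def randSmalls : ℕ → Algorithm K n c t l → Algorithm K n c t l
  | 0, next => next
  | k + 1, next => randSmall (randSmalls k next)

/-- Toss `k` coins. -/
def coins : (k : ℕ) → ((Fin k → Bool) → Algorithm K n c t l) → Algorithm K n c t l
  | 0, next => next Fin.elim0
  | k + 1, next => coin fun b => coins k fun s => next (Fin.cons b s)

/-- Add a list of products to an accumulator. -/
def addProducts : List (Operand n c t × Operand n c t) → Operand n c t → ℕ →
    (Operand n c t → ℕ → Algorithm K n c t l) → Algorithm K n c t l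
  | [], acc, len, k => k acc len
  | (u, v) :: ps, acc, len, k =>
      arith (.mul u v) (arith (.add acc (.reg len))
        (addProducts ps (.reg (len + 1)) (len + 2) k))

/-- Compute `N` sums of products. -/
def dotProducts [Zero K] : (N : ℕ) → (Fin N → List (Operand n c t × Operand n c t)) → ℕ →
    ((Fin N → Operand n c t) → ℕ → Algorithm K n c t l) → Algorithm K n c t l
  | 0, _, len, k => k Fin.elim0 len
  | N + 1, ps, len, k =>
      arith (.const 0) (addProducts (ps 0) (.reg len) (len + 1) fun u len' =>
        dotProducts N (fun i => ps i.succ) len' fun us len'' => k (Fin.cons u us) len'')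

/-- Compute a random linear combination `x = X e` of `r` random elements of the large field, and the
vector `H' xᵀ`. -/
def sample [Zero K] (r len : ℕ)
    (k : (Fin t ⊕ Fin n → Operand n c t) → (Fin c → Operand n c t) → ℕ → Algorithm K n c t l) :
    Algorithm K n c t l :=
  randLarges r <| randSmalls ((t + n) * r) <|
    dotProducts (t + n) (fun j => List.ofFn fun b : Fin r =>
      (.reg (len + r + finProdFinEquiv (j, b)), .reg (len + b))) (len + r + (t + n) * r)
      fun xs len' =>
    dotProducts c (fun i => List.ofFn fun j : Fin (t + n) =>
      (.key i (finSumFinEquiv.symm j), xs j)) len' fun ys len'' =>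
    k (fun i => xs (finSumFinEquiv i)) ys len''

/-- The algorithm that replaces every authentic signature by a simulated one.  The current length of
the memory is `len`; `ρ` lists the operands that correspond to the memory of the given algorithm,
and `known` is the table of the hash values that have been chosen in the simulation. -/
def simulate [Zero K] (r : ℕ) : Algorithm K n c t l → ℕ → List (Operand n c t) →
    (List Bool → Option (Fin c → Operand n c t)) → Algorithm K n c t l
  | output M seed x, len, ρ, _ => output M seed fun i => (x i).rename len ρ
  | arith op next, len, ρ, known =>
      arith (op.rename len ρ) (simulate r next (len + 1) (ρ ++ [.reg len]) known)
  | test u a b, len, ρ, known =>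
      test (u.rename len ρ) (simulate r a len ρ known) (simulate r b len ρ known)
  | coin next, len, ρ, known => coin fun b => simulate r (next b) len ρ known
  | randSmall next, len, ρ, known =>
      randSmall (simulate r next (len + 1) (ρ ++ [.reg len]) known)
  | randLarge next, len, ρ, known =>
      randLarge (simulate r next (len + 1) (ρ ++ [.reg len]) known)
  | hash w next, len, ρ, known =>
      match known w with
      -- The chosen value is already in memory: only the renaming grows, and no step is spent.
      | some ys => simulate r next len (ρ ++ List.ofFn ys) known
      | none => hash w (simulate r next (len + c)
          (ρ ++ List.ofFn fun i : Fin c => .reg (len + i)) known)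
  | sign M next, len, ρ, known =>
      coins l fun seed => sample r len fun xs ys len' =>
        simulate r (next seed) len'
          (ρ ++ List.ofFn (fun i => xs (Sum.inl i)) ++ List.ofFn fun j => xs (Sum.inr j))
          (Function.update known (M ++ List.ofFn seed) (some ys))

/-- Bounds for the resources of an algorithm without authentic signatures. -/
structure Bounds (𝒜 : Algorithm K n c t l) (T h : ℕ) : Prop where
  cost : 𝒜.cost ≤ T
  hashCalls : 𝒜.hashCalls ≤ h
  signCalls : 𝒜.signCalls = 0

theorem Bounds.mono {𝒜 : Algorithm K n c t l} {T T' h h' : ℕ} (H : Bounds 𝒜 T h) (hT : T ≤ T')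
    (hh : h ≤ h') : Bounds 𝒜 T' h' :=
  ⟨H.cost.trans hT, H.hashCalls.trans hh, H.signCalls⟩

theorem Bounds.arith {𝒜 : Algorithm K n c t l} {T h : ℕ} (H : Bounds 𝒜 T h) (op : Arith K n c t) :
    Bounds (Algorithm.arith op 𝒜) (T + 1) h :=
  ⟨Nat.succ_le_succ H.cost, H.hashCalls, H.signCalls⟩

theorem Bounds.randLarges {𝒜 : Algorithm K n c t l} {T h : ℕ} (H : Bounds 𝒜 T h) (k : ℕ) :
    Bounds (Algorithm.randLarges k 𝒜) (T + k) h := by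
  induction k with
  | zero => exact H
  | succ k ih => exact ⟨Nat.succ_le_succ ih.cost, ih.hashCalls, ih.signCalls⟩

theorem Bounds.randSmalls {𝒜 : Algorithm K n c t l} {T h : ℕ} (H : Bounds 𝒜 T h) (k : ℕ) :
    Bounds (Algorithm.randSmalls k 𝒜) (T + k) h := by
  induction k with
  | zero => exact H
  | succ k ih => exact ⟨Nat.succ_le_succ ih.cost, ih.hashCalls, ih.signCalls⟩

theorem Bounds.coin {next : Bool → Algorithm K n c t l} {T h : ℕ}
    (H : ∀ b, Bounds (next b) T h) : Bounds (Algorithm.coin next) (T + 1) h :=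
  ⟨Nat.succ_le_succ (max_le (H _).cost (H _).cost), max_le (H _).hashCalls (H _).hashCalls, by
    simp [Algorithm.signCalls, (H _).signCalls]⟩

theorem Bounds.coins {k : ℕ} {next : (Fin k → Bool) → Algorithm K n c t l} {T h : ℕ}
    (H : ∀ s, Bounds (next s) T h) : Bounds (Algorithm.coins k next) (T + k) h := by
  induction k with
  | zero => exact H _
  | succ k ih => exact Bounds.coin fun b => ih fun s => H _

theorem Bounds.addProducts {k : Operand n c t → ℕ → Algorithm K n c t l} {T h : ℕ}
    (H : ∀ u len, Bounds (k u len) T h) (ps : List (Operand n c t × Operand n c t))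
    (acc : Operand n c t) (len : ℕ) :
    Bounds (Algorithm.addProducts ps acc len k) (T + 2 * ps.length) h := by
  induction ps generalizing acc len with
  | nil => exact H _ _
  | cons p ps ih =>
    exact (((ih _ _).arith _).arith _).mono (by simp only [List.length_cons]; omega) le_rfl

theorem Bounds.dotProducts [Zero K] {N a : ℕ}
    {k : (Fin N → Operand n c t) → ℕ → Algorithm K n c t l}
    {T h : ℕ} (H : ∀ u len, Bounds (k u len) T h)
    (ps : Fin N → List (Operand n c t × Operand n c t)) (hps : ∀ i, (ps i).length = a) (len : ℕ) :
    Bounds (Algorithm.dotProducts N ps len k) (T + N * (1 + 2 * a)) h := by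
  induction N generalizing len with
  | zero => exact (H _ _).mono (by simp) le_rfl
  | succ N ih =>
    refine (Bounds.arith (Bounds.addProducts (fun u len' => ih (fun us len'' => H _ _) _
      (fun i => hps i.succ) _) _ _ _) _).mono ?_ le_rfl
    rw [hps]
    exact le_of_eq (by ring)

/-- The count is `r + (t+n)r` random draws, `(t+n)(1+2r)` steps for `X e` and `c(1+2(t+n))` steps
for `H'xᵀ`: a sum of `a` products takes one step for the initial zero and two per product. -/
theorem Bounds.sample [Zero K] {r : ℕ}
    {k : (Fin t ⊕ Fin n → Operand n c t) → (Fin c → Operand n c t) → ℕ → Algorithm K n c t l}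
    {T h : ℕ} (H : ∀ xs ys len, Bounds (k xs ys len) T h) (len : ℕ) :
    Bounds (Algorithm.sample r len k) (T + 3 * (n + t + 1) * (r + c + 1)) h := by
  refine (Bounds.randLarges (Bounds.randSmalls (Bounds.dotProducts (a := r) (fun xs len' =>
    Bounds.dotProducts (a := t + n) (fun ys len'' => H _ _ _) _ (by simp) _) _
      (by simp) _) _) _).mono ?_ le_rfl
  nlinarith [Nat.zero_le (n * r), Nat.zero_le (t * r), Nat.zero_le (n * c), Nat.zero_le (t * c)]

/-- The renaming and the table of chosen values are built into the tree and cost nothing. Only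
signature requests become longer, by `l` coins and one `sample`. -/
theorem bounds_simulate [Zero K] (r : ℕ) (𝒜 : Algorithm K n c t l) (N : ℕ) (hN : 𝒜.signCalls ≤ N)
    (len : ℕ) (ρ : List (Operand n c t)) (known : List Bool → Option (Fin c → Operand n c t)) :
    Bounds (simulate r 𝒜 len ρ known)
      (𝒜.cost + N * (3 * (n + t + 1) * (r + c + 1) + l)) 𝒜.hashCalls := by
  induction 𝒜 generalizing N len ρ known with
  | output M seed x => exact ⟨Nat.le_add_right _ _, le_rfl, rfl⟩
  | arith op next ih =>
    exact ((ih N hN _ _ _).arith _).mono (by simp only [Algorithm.cost]; omega) le_rfl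
  | test u a b iha ihb =>
    simp only [Algorithm.signCalls, max_le_iff] at hN
    have ha := iha N hN.1 len ρ known
    have hb := ihb N hN.2 len ρ known
    refine ⟨?_, ?_, ?_⟩
    · have := ha.cost
      have := hb.cost
      simp only [simulate, Algorithm.cost]
      omega
    · exact max_le_max ha.hashCalls hb.hashCalls
    · simp [simulate, Algorithm.signCalls, ha.signCalls, hb.signCalls]
  | coin next ih =>
    simp only [Algorithm.signCalls, max_le_iff] at hN
    refine (Bounds.coin (T := max (next true).cost (next false).cost +
      N * (3 * (n + t + 1) * (r + c + 1) + l))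
      (h := max (next true).hashCalls (next false).hashCalls) ?_).mono ?_ le_rfl
    · rintro (_ | _)
      · exact (ih false N hN.2 len ρ known).mono (by gcongr; exact le_max_right _ _)
          (le_max_right _ _)
      · exact (ih true N hN.1 len ρ known).mono (by gcongr; exact le_max_left _ _)
          (le_max_left _ _)
    · simp only [Algorithm.cost]
      omega
  | randSmall next ih =>
    exact ((ih N hN _ _ _).randSmalls 1).mono (by simp only [Algorithm.cost]; omega) le_rfl
  | randLarge next ih =>
    exact ((ih N hN _ _ _).randLarges 1).mono (by simp only [Algorithm.cost]; omega) le_rfl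
  | hash w next ih =>
    rw [simulate]
    split
    · exact (ih N hN _ _ _).mono (by simp only [Algorithm.cost]; omega) (Nat.le_succ _)
    · have h := ih N hN (len + c) (ρ ++ List.ofFn fun i : Fin c => .reg (len + i)) known
      refine ⟨?_, Nat.succ_le_succ h.hashCalls, h.signCalls⟩
      have := h.cost
      simp only [Algorithm.cost]
      omega
  | sign M next ih =>
    simp only [Algorithm.signCalls] at hN
    obtain ⟨N, rfl⟩ : ∃ k, N = k + 1 := ⟨N - 1, by omega⟩
    have hle : ∀ seed, (next seed).signCalls ≤ N := fun seed =>
      (Finset.le_sup (f := fun seed => (next seed).signCalls) (Finset.mem_univ seed)).trans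
        (Nat.le_of_succ_le_succ hN)
    refine (Bounds.coins (T := (Finset.univ.sup fun seed => (next seed).cost) +
      N * (3 * (n + t + 1) * (r + c + 1) + l) + 3 * (n + t + 1) * (r + c + 1))
      (h := Finset.univ.sup fun seed => (next seed).hashCalls) fun seed =>
      Bounds.sample (fun xs ys len' => (ih seed N (hle seed) len' _ _).mono ?_ ?_) len).mono
        ?_ le_rfl
    · gcongr
      exact Finset.le_sup (f := fun seed => (next seed).cost) (Finset.mem_univ seed)
    · exact Finset.le_sup (f := fun seed => (next seed).hashCalls) (Finset.mem_univ seed)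
    · simp only [Algorithm.cost]
      rw [add_mul]
      omega

end Algorithm

end Programs

/-! ### Runs of the sampling programs. -/

section Semantics

open Algorithm

variable {F K : Type*} [Field F] [Field K] [Fintype F] [Fintype K] [Algebra F K] {n c t l : ℕ}
  {H' : Matrix (Fin c) (Fin t ⊕ Fin n) K} {r : ℕ} {signer : Signer K n c t l}

theorem average_succ {α : Type*} [Fintype α] (k : ℕ) (f : (Fin (k + 1) → α) → ℝ≥0∞) :
    (Fintype.card (Fin (k + 1) → α) : ℝ≥0∞)⁻¹ * ∑ e, f e =
      ∑ a, (Fintype.card α : ℝ≥0∞)⁻¹ *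
        ((Fintype.card (Fin k → α) : ℝ≥0∞)⁻¹ * ∑ e, f (Fin.cons a e)) := by
  rw [← (Fin.consEquiv fun _ => α).sum_comp, Fintype.sum_prod_type, Finset.mul_sum]
  refine Finset.sum_congr rfl fun a _ => ?_
  rw [← mul_assoc, ← ENNReal.mul_inv (Or.inr (ENNReal.natCast_ne_top _))
    (Or.inl (ENNReal.natCast_ne_top _))]
  congr 2
  simp [pow_succ']

theorem run_randLarges (k : ℕ) (next : Algorithm K n c t l) (st : State K c)
    (a : Option (List Bool × (Fin l → Bool) × (Fin t ⊕ Fin n → K))) :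
    run F H' r signer (randLarges k next) st a =
      (Fintype.card (Fin k → K) : ℝ≥0∞)⁻¹ *
        ∑ e : Fin k → K, run F H' r signer next { st with mem := st.mem ++ List.ofFn e } a := by
  induction k generalizing st with
  | zero => simp [randLarges]
  | succ k ih =>
    rw [average_succ, randLarges, run, PMF.bind_apply, tsum_fintype]
    refine Finset.sum_congr rfl fun b _ => ?_
    rw [PMF.uniformOfFintype_apply, ih]
    simp [List.ofFn_succ]

theorem run_randSmalls (k : ℕ) (next : Algorithm K n c t l) (st : State K c)
    (a : Option (List Bool × (Fin l → Bool) × (Fin t ⊕ Fin n → K))) :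
    run F H' r signer (randSmalls k next) st a =
      (Fintype.card (Fin k → F) : ℝ≥0∞)⁻¹ *
        ∑ e : Fin k → F, run F H' r signer next
          { st with mem := st.mem ++ List.ofFn fun i => algebraMap F K (e i) } a := by
  induction k generalizing st with
  | zero => simp [randSmalls]
  | succ k ih =>
    rw [average_succ, randSmalls, run, PMF.bind_apply, tsum_fintype]
    refine Finset.sum_congr rfl fun b _ => ?_
    rw [PMF.uniformOfFintype_apply, ih]
    simp [List.ofFn_succ]

theorem run_coins (k : ℕ) (next : (Fin k → Bool) → Algorithm K n c t l) (st : State K c)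
    (a : Option (List Bool × (Fin l → Bool) × (Fin t ⊕ Fin n → K))) :
    run F H' r signer (coins k next) st a =
      (Fintype.card (Fin k → Bool) : ℝ≥0∞)⁻¹ *
        ∑ s : Fin k → Bool, run F H' r signer (next s) st a := by
  induction k with
  | zero =>
    simp [coins]
    congr!
  | succ k ih =>
    rw [average_succ, coins, run, PMF.bind_apply, tsum_fintype]
    refine Finset.sum_congr rfl fun b _ => ?_
    rw [PMF.uniformOfFintype_apply, ih]

/-- The resulting operand and memory suffix are produced before the continuation is quantified, so
they are the same for every `k` and programs can be chained. -/
theorem run_addProducts (ps : List (Operand n c t × Operand n c t)) (acc : Operand n c t)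
    (st : State K c) (hps : ∀ p ∈ ps, p.1.Bounded st.mem.length ∧ p.2.Bounded st.mem.length)
    (hacc : acc.Bounded st.mem.length) :
    ∃ (u : Operand n c t) (suf : List K), u.Bounded (st.mem ++ suf).length ∧
      u.eval H' (st.mem ++ suf) = acc.eval H' st.mem +
        (ps.map fun p => p.1.eval H' st.mem * p.2.eval H' st.mem).sum ∧
      ∀ k : Operand n c t → ℕ → Algorithm K n c t l,
        run F H' r signer (addProducts ps acc st.mem.length k) st =
          run F H' r signer (k u (st.mem ++ suf).length) { st with mem := st.mem ++ suf } := by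
  induction ps generalizing acc st with
  | nil => exact ⟨acc, [], by simpa using hacc, by simp, fun k => by simp [addProducts]⟩
  | cons p ps ih =>
    obtain ⟨u, v⟩ := p
    have huv := hps _ List.mem_cons_self
    set x := u.eval H' st.mem * v.eval H' st.mem with hx
    set y := acc.eval H' st.mem + x with hy
    have hlen : (st.mem ++ [x, y]).length = st.mem.length + 2 := by simp
    obtain ⟨w, suf, h1, h2, h3⟩ := ih (.reg (st.mem.length + 1))
      { st with mem := st.mem ++ [x, y] }
      (fun p hp => by
        have := hps p (List.mem_cons_of_mem _ hp)
        simp only [hlen]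
        exact ⟨this.1.mono (by omega), this.2.mono (by omega)⟩)
      (by simp [hlen, Operand.Bounded])
    refine ⟨w, [x, y] ++ suf, by simpa using h1, ?_, ?_⟩
    · rw [← List.append_assoc, h2]
      have e1 : (Operand.reg (st.mem.length + 1) : Operand n c t).eval H' (st.mem ++ [x, y]) = y := by
        simp [Operand.eval, List.getD_eq_getElem?_getD]
      rw [e1, List.map_cons, List.sum_cons, hy, add_assoc]
      congr 2
      congr 1
      refine List.map_congr_left fun p hp => ?_
      have := hps p (List.mem_cons_of_mem _ hp)
      rw [Operand.eval_append this.1, Operand.eval_append this.2]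
    · intro k
      have e2 : (Operand.reg st.mem.length : Operand n c t).eval H' (st.mem ++ [x]) = x := by
        simp [Operand.eval, List.getD_eq_getElem?_getD]
      have h4 := h3 k
      simp only [hlen] at h4
      rw [addProducts, run, run]
      simp only [Arith.eval, e2, Operand.eval_append hacc, ← hx, ← hy, List.append_assoc,
        List.cons_append, List.nil_append] at h4 ⊢
      exact h4

theorem run_dotProducts (N : ℕ) (ps : Fin N → List (Operand n c t × Operand n c t))
    (st : State K c)
    (hps : ∀ i, ∀ p ∈ ps i, p.1.Bounded st.mem.length ∧ p.2.Bounded st.mem.length) :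
    ∃ (us : Fin N → Operand n c t) (suf : List K), (∀ i, (us i).Bounded (st.mem ++ suf).length) ∧
      (∀ i, (us i).eval H' (st.mem ++ suf) =
        ((ps i).map fun p => p.1.eval H' st.mem * p.2.eval H' st.mem).sum) ∧
      ∀ k : (Fin N → Operand n c t) → ℕ → Algorithm K n c t l,
        run F H' r signer (dotProducts N ps st.mem.length k) st =
          run F H' r signer (k us (st.mem ++ suf).length) { st with mem := st.mem ++ suf } := by
  induction N generalizing st with
  | zero =>
    exact ⟨Fin.elim0, [], fun i => i.elim0, fun i => i.elim0, fun k => by simp [dotProducts]⟩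
  | succ N ih =>
    have hlen : (st.mem ++ [(0 : K)]).length = st.mem.length + 1 := by simp
    obtain ⟨u, suf, h1, h2, h3⟩ := run_addProducts (F := F) (H' := H') (r := r)
      (signer := signer) (ps 0) (.reg st.mem.length) { st with mem := st.mem ++ [0] }
      (fun p hp => by
        have := hps 0 p hp
        simp only [hlen]
        exact ⟨this.1.mono (by omega), this.2.mono (by omega)⟩)
      (by simp [hlen, Operand.Bounded])
    dsimp only at h1 h2 h3
    obtain ⟨us, suf', h1', h2', h3'⟩ := ih (fun i => ps i.succ)
      { st with mem := st.mem ++ [0] ++ suf }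
      (fun i p hp => by
        have := hps i.succ p hp
        simp only [List.length_append]
        exact ⟨this.1.mono (by omega), this.2.mono (by omega)⟩)
    dsimp only at h1' h2' h3'
    have hassoc : st.mem ++ ([0] ++ suf ++ suf') = st.mem ++ [0] ++ suf ++ suf' := by simp
    refine ⟨Fin.cons u us, [0] ++ suf ++ suf', ?_, ?_, ?_⟩
    · rw [hassoc]
      intro i
      refine Fin.cases ?_ (fun i => ?_) i
      · exact h1.mono (by simp)
      · exact h1' i
    · rw [hassoc]
      intro i
      refine Fin.cases ?_ (fun i => ?_) i
      · rw [Fin.cons_zero, Operand.eval_append h1, h2]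
        have e1 : (Operand.reg st.mem.length : Operand n c t).eval H' (st.mem ++ [0]) = 0 := by
          simp [Operand.eval, List.getD_eq_getElem?_getD]
        rw [e1, zero_add]
        congr 1
        refine List.map_congr_left fun p hp => ?_
        have := hps 0 p hp
        rw [Operand.eval_append this.1, Operand.eval_append this.2]
      · rw [Fin.cons_succ, h2']
        congr 1
        refine List.map_congr_left fun p hp => ?_
        have := hps i.succ p hp
        rw [List.append_assoc, Operand.eval_append this.1, Operand.eval_append this.2]
    · intro k
      rw [hassoc, dotProducts, run, Arith.eval, ← hlen, h3, h3']

/-- Running `sample` amounts to choosing a random vector `x = X e`. -/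
theorem run_sample (st : State K c) (a : Option (List Bool × (Fin l → Bool) × (Fin t ⊕ Fin n → K)))
    (k : (Fin t ⊕ Fin n → Operand n c t) → (Fin c → Operand n c t) → ℕ → Algorithm K n c t l)
    (f : (Fin t ⊕ Fin n → K) → ℝ≥0∞)
    (hf : ∀ (x : Fin t ⊕ Fin n → K) (suf : List K) (xs : Fin t ⊕ Fin n → Operand n c t)
      (ys : Fin c → Operand n c t), (∀ i, (xs i).Bounded (st.mem ++ suf).length) →
      (∀ i, (ys i).Bounded (st.mem ++ suf).length) →
      (∀ i, (xs i).eval H' (st.mem ++ suf) = x i) →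
      (∀ i, (ys i).eval H' (st.mem ++ suf) = H'.mulVec x i) →
      f x ≤ run F H' r signer (k xs ys (st.mem ++ suf).length) { st with mem := st.mem ++ suf } a) :
    (Fintype.card ((Fin r → K) × (Fin t ⊕ Fin n → Fin r → F)) : ℝ≥0∞)⁻¹ *
        ∑ p : (Fin r → K) × (Fin t ⊕ Fin n → Fin r → F), f (combine p) ≤
      run F H' r signer (sample r st.mem.length k) st a := by
  -- `E` regroups the flat list of small-field draws into the matrix `X`, in the order in which
  -- `sample` addresses them.
  let E : (Fin ((t + n) * r) → F) ≃ (Fin t ⊕ Fin n → Fin r → F) :=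
    ((finProdFinEquiv.symm.arrowCongr (Equiv.refl F)).trans (Equiv.curry _ _ _)).trans
      (finSumFinEquiv.symm.arrowCongr (Equiv.refl _))
  rw [sample, run_randLarges, Fintype.card_prod, Nat.cast_mul, ENNReal.mul_inv
    (Or.inr (ENNReal.natCast_ne_top _)) (Or.inl (ENNReal.natCast_ne_top _)), mul_assoc,
    Fintype.sum_prod_type, Finset.mul_sum]
  gcongr with e
  rw [run_randSmalls, ← Fintype.card_congr E]
  gcongr
  rw [← E.sum_comp]
  gcongr with X
  set mem := st.mem ++ List.ofFn e ++ List.ofFn (fun i => algebraMap F K (X i)) with hmem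
  have hlen : mem.length = st.mem.length + r + (t + n) * r := by simp [hmem, add_assoc]
  obtain ⟨xs, suf, h1, h2, h3⟩ := run_dotProducts (F := F) (H' := H') (r := r)
    (signer := signer) (t + n) (fun j => List.ofFn fun b : Fin r =>
      ((.reg (st.mem.length + r + finProdFinEquiv (j, b)) : Operand n c t),
        (.reg (st.mem.length + b) : Operand n c t)))
    { st with mem := mem } (by
      intro i p hp
      obtain ⟨b, rfl⟩ := List.mem_ofFn.1 hp
      simp only [Operand.Bounded, hlen]
      have h1 := (finProdFinEquiv (i, b)).2
      have h2 := b.2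
      exact ⟨by omega, by omega⟩)
  dsimp only at h1 h2 h3
  obtain ⟨ys, suf', h1', h2', h3'⟩ := run_dotProducts (F := F) (H' := H') (r := r)
    (signer := signer) c (fun i => List.ofFn fun j : Fin (t + n) =>
      ((.key i (finSumFinEquiv.symm j) : Operand n c t), xs j))
    { st with mem := mem ++ suf } (by
      intro i p hp
      obtain ⟨b, rfl⟩ := List.mem_ofFn.1 hp
      exact ⟨trivial, h1 b⟩)
  dsimp only at h1' h2' h3'
  rw [← hlen, h3, h3']
  have hxs : ∀ i, (xs (finSumFinEquiv i)).eval H' (mem ++ suf) = combine (e, E X) i := by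
    intro i
    rw [h2, List.map_ofFn, List.sum_ofFn, combine]
    refine Finset.sum_congr rfl fun b _ => ?_
    have e1 := Operand.eval_reg_append_ofFn (H' := H') (st.mem ++ List.ofFn e)
      (fun i => algebraMap F K (X i)) [] (finProdFinEquiv (finSumFinEquiv i, b))
    have e2 := Operand.eval_reg_append_ofFn (H' := H') st.mem e
      (List.ofFn fun i => algebraMap F K (X i)) b
    rw [List.append_nil, List.length_append, List.length_ofFn] at e1
    rw [Function.comp_apply, e1, e2, Algebra.smul_def]
    rfl
  have hsplit : mem ++ suf ++ suf' =
      st.mem ++ (List.ofFn e ++ List.ofFn (fun i => algebraMap F K (X i)) ++ suf ++ suf') := by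
    simp [hmem]
  rw [hsplit]
  apply hf
  · intro i
    rw [← hsplit]
    exact (h1 _).mono (by simp)
  · intro i
    rw [← hsplit]
    exact h1' i
  · intro i
    rw [← hsplit, Operand.eval_append (h1 _), hxs]
  · intro i
    rw [← hsplit, h2', List.map_ofFn, List.sum_ofFn, Matrix.mulVec, dotProduct,
      ← finSumFinEquiv.symm.sum_comp]
    refine Finset.sum_congr rfl fun j _ => ?_
    rw [Function.comp_apply, ← hxs, Equiv.apply_symm_apply]
    rfl

end Semantics

/-! ### The authentic signer -/

/-- The state after a rejected attempt. -/
def State.reject {K : Type*} {c : ℕ} (st : State K c) (w : List Bool) (y : Fin c → K) : State K c where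
  mem := st.mem
  table := Function.update st.table w (some y)
  signed := st.signed
  rejected := w :: st.rejected
  fresh := st.fresh && (st.table w).isNone

/-- The state after a successful attempt. -/
def State.accept {K : Type*} {c : ℕ} (st : State K c) (M w : List Bool) (y : Fin c → K) : State K c where
  mem := st.mem
  table := Function.update st.table w (some y)
  signed := M :: st.signed
  rejected := st.rejected
  fresh := st.fresh && (st.table w).isNone

section SignerRuns

variable {F K α : Type*} [Field F] [Field K] [Fintype K] [Algebra F K] {n c d t l : ℕ}

theorem oracleValue_of_none {table : List Bool → Option (Fin c → K)} {w : List Bool}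
    (h : table w = none) : oracleValue table w = PMF.uniformOfFintype (Fin c → K) := by
  simp [oracleValue, h]

theorem oracleValue_of_some {table : List Bool → Option (Fin c → K)} {w : List Bool}
    {y : Fin c → K} (h : table w = some y) : oracleValue table w = PMF.pure y := by
  simp [oracleValue, h]

theorem oracleValue_congr {table table' : List Bool → Option (Fin c → K)} {w : List Bool}
    (h : table w = table' w) : oracleValue table w = oracleValue table' w := by
  simp [oracleValue, h]

variable (sk : SecretKey F K n c d t) (r : ℕ)
  (g : Option ((Fin t ⊕ Fin n → K) × (Fin l → Bool) × State K c) → PMF α) (a : α)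

theorem signer_succ_bind_apply (L : ℕ) (M : List Bool) (st : State K c) :
    ((sk.signer r (L + 1) M st).bind g) a =
      ∑ seed : Fin l → Bool, (Fintype.card (Fin l → Bool) : ℝ≥0∞)⁻¹ *
        ∑ y, oracleValue st.table (M ++ List.ofFn seed) y *
          (sk.attempt r y none *
              ((sk.signer r L M (st.reject (M ++ List.ofFn seed) y)).bind g) a +
            ∑ x, sk.attempt r y (some x) *
              g (some (x, seed, st.accept M (M ++ List.ofFn seed) y)) a) := by
  rw [SecretKey.signer, PMF.bind_bind, PMF.bind_apply, tsum_fintype]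
  refine Finset.sum_congr rfl fun seed _ => ?_
  rw [PMF.uniformOfFintype_apply, PMF.bind_bind, PMF.bind_apply, tsum_fintype]
  congr 1
  refine Finset.sum_congr rfl fun y _ => ?_
  rw [PMF.bind_bind, PMF.bind_apply, tsum_fintype, Fintype.sum_option]
  congr 2
  refine Finset.sum_congr rfl fun x _ => ?_
  rw [PMF.pure_bind]
  rfl

/-- Freshness, once lost, is never regained by the signer. -/
theorem signer_bind_eq_zero (hnone : g none a = 0)
    (hg : ∀ x seed st, st.fresh = false → g (some (x, seed, st)) a = 0) (L : ℕ) (M : List Bool)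
    (st : State K c) (hst : st.fresh = false) :
    ((sk.signer r L M st).bind g) a = 0 := by
  induction L generalizing st with
  | zero => rw [SecretKey.signer, PMF.pure_bind, hnone]
  | succ L ih =>
    rw [signer_succ_bind_apply]
    refine Finset.sum_eq_zero fun seed _ => ?_
    rw [Finset.sum_eq_zero, mul_zero]
    intro y _
    rw [ih _ (by simp [State.reject, hst]), Finset.sum_eq_zero, mul_zero, add_zero, mul_zero]
    intro x _
    rw [hg _ _ _ (by simp [State.accept, hst]), mul_zero]

/-- The answers of the authentic signer, in a run with fresh hash calls, are dominated by a random
seed with an independent genuine signature. -/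
theorem signer_bind_le (hnone : g none a = 0)
    (hg : ∀ x seed st, st.fresh = false → g (some (x, seed, st)) a = 0) (M : List Bool)
    (I : State K c → Prop) (m : (Fin l → Bool) → (Fin t ⊕ Fin n → K) → ℝ≥0∞)
    (hreject : ∀ (st : State K c) (seed : Fin l → Bool) y, I st →
      st.table (M ++ List.ofFn seed) = none → I (st.reject (M ++ List.ofFn seed) y))
    (haccept : ∀ (st : State K c) (seed : Fin l → Bool) x, I st →
      st.table (M ++ List.ofFn seed) = none →
      g (some (x, seed, st.accept M (M ++ List.ofFn seed) (sk.publicKey.mulVec x))) a ≤ m seed x)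
    (L : ℕ) (st : State K c) (hst : I st) :
    ((sk.signer r L M st).bind g) a ≤
      ∑ seed : Fin l → Bool, (Fintype.card (Fin l → Bool) : ℝ≥0∞)⁻¹ *
        ∑ x, sk.genuineLaw r (x, sk.publicKey.mulVec x) * m seed x := by
  classical
  set S := (Fintype.card (Fin l → Bool) : ℝ≥0∞)⁻¹ with hS
  set f := sk.freshAttempt r with hf
  set B : (Fin l → Bool) → ℝ≥0∞ := fun seed =>
    ∑ x, f (some (x, sk.publicKey.mulVec x)) * m seed x with hB
  have hSsum : ∑ _seed : Fin l → Bool, S = 1 := by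
    rw [Finset.sum_const, Finset.card_univ, nsmul_eq_mul, hS, ENNReal.mul_inv_cancel
      (Nat.cast_ne_zero.2 Fintype.card_ne_zero) (ENNReal.natCast_ne_top _)]
  -- With at most `L` attempts the bound is a partial geometric series. Attempts on old hash inputs
  -- contribute nothing, so each attempt that counts has a uniform hash value.
  have key : ∀ L st, I st → ((sk.signer r L M st).bind g) a ≤
      (∑ j ∈ Finset.range L, f none ^ j) * ∑ seed, S * B seed := by
    intro L
    induction L with
    | zero =>
      intro st _
      rw [SecretKey.signer, PMF.pure_bind, hnone]
      exact zero_le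
    | succ L ih =>
      intro st hst
      rw [signer_succ_bind_apply, ← hS]
      set T := (∑ j ∈ Finset.range L, f none ^ j) * ∑ seed, S * B seed with hT
      have hstep : ∀ seed : Fin l → Bool,
          ∑ y, oracleValue st.table (M ++ List.ofFn seed) y *
            (sk.attempt r y none *
              ((sk.signer r L M (st.reject (M ++ List.ofFn seed) y)).bind g) a +
            ∑ x, sk.attempt r y (some x) *
              g (some (x, seed, st.accept M (M ++ List.ofFn seed) y)) a) ≤ f none * T + B seed := by
        intro seed
        cases hw : st.table (M ++ List.ofFn seed) with
        | some y0 =>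
          rw [Finset.sum_eq_zero]
          · exact zero_le
          · intro y _
            rw [signer_bind_eq_zero sk r g a hnone hg _ _ _ (by simp [State.reject, hw]),
              Finset.sum_eq_zero, mul_zero, add_zero, mul_zero]
            intro x _
            rw [hg _ _ _ (by simp [State.accept, hw]), mul_zero]
        | none =>
          rw [oracleValue_of_none hw]
          simp only [PMF.uniformOfFintype_apply, mul_add, Finset.sum_add_distrib]
          gcongr
          · rw [hf, SecretKey.freshAttempt_none, Finset.sum_mul]
            refine Finset.sum_le_sum fun y _ => ?_
            rw [mul_assoc]
            gcongr
            exact ih _ (hreject st seed y hst hw)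
          · simp only [Finset.mul_sum]
            rw [Finset.sum_comm]
            refine Finset.sum_le_sum fun x _ => ?_
            -- An attempt returns `x` only for the hash value `H'x`.
            rw [Finset.sum_eq_single (sk.publicKey.mulVec x) _ (by simp)]
            · rw [← mul_assoc]
              refine mul_le_mul' (le_of_eq ?_) (haccept st seed x hst hw)
              rw [hf, SecretKey.freshAttempt_some, SecretKey.attempt_some]
              split_ifs <;> simp
            · intro y _ hy
              rw [SecretKey.attempt_some, if_neg fun h => hy h.2.symm, zero_mul, mul_zero]
      calc _ ≤ ∑ seed, S * (f none * T + B seed) := by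
            gcongr with seed
            exact hstep seed
        _ = f none * T + ∑ seed, S * B seed := by
            simp only [mul_add, Finset.sum_add_distrib]
            rw [← Finset.sum_mul, hSsum, one_mul]
        _ = _ := by
            rw [Finset.sum_range_succ', hT]
            simp only [pow_succ', ← Finset.mul_sum, pow_zero, add_mul, one_mul, mul_assoc]
  refine (key L st hst).trans ?_
  rw [Finset.mul_sum]
  refine Finset.sum_le_sum fun seed _ => ?_
  rw [mul_left_comm, hB]
  gcongr
  rw [Finset.mul_sum]
  refine Finset.sum_le_sum fun x _ => ?_
  rw [← mul_assoc]
  exact mul_le_mul' (sk.sum_pow_mul_freshAttempt_le r L _) le_rfl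

end SignerRuns

/-! ### Comparison of the games -/

section Comparison

variable {K : Type*} [Field K] {n c t l : ℕ}

/-- The relation between a run with authentic signatures and its simulation. -/
structure Simulates (l : ℕ) (H' : Matrix (Fin c) (Fin t ⊕ Fin n) K) (signed : List (List Bool))
    (mem : List K) (table : List Bool → Option (Fin c → K)) (rejected : List (List Bool))
    (mem' : List K) (table' : List Bool → Option (Fin c → K)) (ρ : List (Operand n c t))
    (known : List Bool → Option (Fin c → Operand n c t)) : Prop where
  mem_eq : mem = ρ.map (Operand.eval H' mem')
  bounded : ∀ u ∈ ρ, u.Bounded mem'.length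
  known_bounded : ∀ w ys, known w = some ys → ∀ i, (ys i).Bounded mem'.length
  known_table : ∀ w ys, known w = some ys → table w = some fun i => (ys i).eval H' mem'
  known_signed : ∀ w ys, known w = some ys →
    ∃ M ∈ signed, ∃ seed : Fin l → Bool, w = M ++ List.ofFn seed
  table_eq : ∀ w, known w = none → w ∉ rejected → table w = table' w
  rejected_table : ∀ w ∈ rejected, table w ≠ none
  rejected_signed : ∀ w ∈ rejected, ∃ M ∈ signed, ∃ seed : Fin l → Bool, w = M ++ List.ofFn seed

namespace Simulates

variable {H' : Matrix (Fin c) (Fin t ⊕ Fin n) K} {signed : List (List Bool)}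
  {mem : List K} {table : List Bool → Option (Fin c → K)} {rejected : List (List Bool)}
  {mem' : List K} {table' : List Bool → Option (Fin c → K)} {ρ : List (Operand n c t)}
  {known : List Bool → Option (Fin c → Operand n c t)}

theorem init : Simulates l H' [] [] (fun _ => none) [] [] (fun _ => none) [] (fun _ => none) := by
  constructor <;> simp

theorem extend (h : Simulates l H' signed mem table rejected mem' table' ρ known) (suf : List K)
    (us : List (Operand n c t)) (hus : ∀ u ∈ us, u.Bounded (mem' ++ suf).length) :
    Simulates l H' signed (mem ++ us.map (Operand.eval H' (mem' ++ suf))) table rejected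
      (mem' ++ suf) table' (ρ ++ us) known where
  mem_eq := by
    rw [List.map_append, h.mem_eq]
    congr 1
    exact List.map_congr_left fun u hu => (Operand.eval_append (h.bounded u hu) _).symm
  bounded u hu := by
    rcases List.mem_append.1 hu with hu | hu
    · exact (h.bounded u hu).mono (by simp)
    · exact hus u hu
  known_bounded w ys hw i := (h.known_bounded w ys hw i).mono (by simp)
  known_table w ys hw := by
    rw [h.known_table w ys hw]
    congr 1
    funext i
    exact (Operand.eval_append (h.known_bounded w ys hw i) _).symm
  known_signed := h.known_signed
  table_eq := h.table_eq
  rejected_table := h.rejected_table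
  rejected_signed := h.rejected_signed

theorem extend_single (h : Simulates l H' signed mem table rejected mem' table' ρ known) (a : K) :
    Simulates l H' signed (mem ++ [a]) table rejected (mem' ++ [a]) table'
      (ρ ++ [.reg mem'.length]) known := by
  have := h.extend [a] [.reg mem'.length] (by simp [Operand.Bounded])
  simpa [Operand.eval, List.getD_eq_getElem?_getD] using this

theorem hash (h : Simulates l H' signed mem table rejected mem' table' ρ known) {w : List Bool}
    (hw : known w = none) (y : Fin c → K) :
    Simulates l H' signed mem (Function.update table w (some y)) rejected mem'
      (Function.update table' w (some y)) ρ known where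
  mem_eq := h.mem_eq
  bounded := h.bounded
  known_bounded := h.known_bounded
  known_table v ys hv := by
    rw [Function.update_of_ne (by rintro rfl; rw [hw] at hv; cases hv)]
    exact h.known_table v ys hv
  known_signed := h.known_signed
  table_eq v hv hv' := by
    by_cases hvw : v = w
    · subst hvw; simp
    · rw [Function.update_of_ne hvw, Function.update_of_ne hvw, h.table_eq v hv hv']
  rejected_table v hv := by
    by_cases hvw : v = w
    · subst hvw; simp
    · rw [Function.update_of_ne hvw]
      exact h.rejected_table v hv
  rejected_signed := h.rejected_signed

theorem mono (h : Simulates l H' signed mem table rejected mem' table' ρ known) (M : List Bool) :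
    Simulates l H' (M :: signed) mem table rejected mem' table' ρ known where
  mem_eq := h.mem_eq
  bounded := h.bounded
  known_bounded := h.known_bounded
  known_table := h.known_table
  known_signed w ys hw := by
    obtain ⟨M', hM', h'⟩ := h.known_signed w ys hw
    exact ⟨M', List.mem_cons_of_mem _ hM', h'⟩
  table_eq := h.table_eq
  rejected_table := h.rejected_table
  rejected_signed w hw := by
    obtain ⟨M', hM', h'⟩ := h.rejected_signed w hw
    exact ⟨M', List.mem_cons_of_mem _ hM', h'⟩

theorem reject (h : Simulates l H' signed mem table rejected mem' table' ρ known) {M : List Bool}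
    (hM : M ∈ signed) (seed : Fin l → Bool) (hw : table (M ++ List.ofFn seed) = none)
    (y : Fin c → K) :
    Simulates l H' signed mem (Function.update table (M ++ List.ofFn seed) (some y))
      ((M ++ List.ofFn seed) :: rejected) mem' table' ρ known where
  mem_eq := h.mem_eq
  bounded := h.bounded
  known_bounded := h.known_bounded
  known_table v ys hv := by
    have h1 := h.known_table v ys hv
    rw [Function.update_of_ne (by rintro rfl; rw [hw] at h1; cases h1), h1]
  known_signed := h.known_signed
  table_eq v hv hv' := by
    rw [List.mem_cons, not_or] at hv'
    rw [Function.update_of_ne hv'.1]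
    exact h.table_eq v hv hv'.2
  rejected_table v hv := by
    by_cases hvw : v = M ++ List.ofFn seed
    · subst hvw; simp
    · rw [Function.update_of_ne hvw]
      exact h.rejected_table v ((List.mem_cons.1 hv).resolve_left hvw)
  rejected_signed v hv := by
    rcases List.mem_cons.1 hv with rfl | hv
    · exact ⟨M, hM, seed, rfl⟩
    · exact h.rejected_signed v hv

theorem accept (h : Simulates l H' signed mem table rejected mem' table' ρ known) {M : List Bool}
    (hM : M ∈ signed) (seed : Fin l → Bool) (ys : Fin c → Operand n c t)
    (hys : ∀ i, (ys i).Bounded mem'.length) :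
    Simulates l H' signed mem (Function.update table (M ++ List.ofFn seed)
      (some fun i => (ys i).eval H' mem')) rejected mem' table' ρ
      (Function.update known (M ++ List.ofFn seed) (some ys)) where
  mem_eq := h.mem_eq
  bounded := h.bounded
  known_bounded v zs hv := by
    by_cases hvw : v = M ++ List.ofFn seed
    · subst hvw
      rw [Function.update_self, Option.some_inj] at hv
      exact hv ▸ hys
    · rw [Function.update_of_ne hvw] at hv
      exact h.known_bounded v zs hv
  known_table v zs hv := by
    by_cases hvw : v = M ++ List.ofFn seed
    · subst hvw
      rw [Function.update_self, Option.some_inj] at hv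
      rw [Function.update_self, hv]
    · rw [Function.update_of_ne hvw] at hv ⊢
      exact h.known_table v zs hv
  known_signed v zs hv := by
    by_cases hvw : v = M ++ List.ofFn seed
    · exact ⟨M, hM, seed, hvw⟩
    · rw [Function.update_of_ne hvw] at hv
      exact h.known_signed v zs hv
  table_eq v hv hv' := by
    by_cases hvw : v = M ++ List.ofFn seed
    · subst hvw
      simp at hv
    · rw [Function.update_of_ne hvw] at hv ⊢
      exact h.table_eq v hv hv'
  rejected_table v hv := by
    by_cases hvw : v = M ++ List.ofFn seed
    · subst hvw; simp
    · rw [Function.update_of_ne hvw]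
      exact h.rejected_table v hv
  rejected_signed := h.rejected_signed

/-- On hash inputs for messages that have not been signed, the two oracles agree. -/
theorem table_eq_of_not_mem (h : Simulates l H' signed mem table rejected mem' table' ρ known)
    {M : List Bool} (hM : M ∉ signed) (seed : Fin l → Bool) :
    table (M ++ List.ofFn seed) = table' (M ++ List.ofFn seed) := by
  have hne : ¬ ∃ M' ∈ signed, ∃ seed' : Fin l → Bool,
      M ++ List.ofFn seed = M' ++ List.ofFn seed' := by
    rintro ⟨M', hM', seed', he⟩
    -- All seeds have length `l`, so a hash input determines its message.
    have := (List.append_inj' he (by simp)).1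
    exact hM (this ▸ hM')
  apply h.table_eq
  · rw [Option.eq_none_iff_forall_ne_some]
    exact fun ys hys => hne (h.known_signed _ ys hys)
  · exact fun hr => hne (h.rejected_signed _ hr)

end Simulates

end Comparison

section Comparison

variable {F K : Type*} [Field F] [Field K] [Fintype F] [Fintype K] [Algebra F K] {n c d t l : ℕ}
variable (sk : SecretKey F K n c d t) {r : ℕ}

/-- A run in which some hash call was not fresh does not count. -/
theorem run_eq_zero_of_not_fresh (L : ℕ) (𝒜 : Algorithm K n c t l) (st : State K c)
    (hst : st.fresh = false) (o : List Bool × (Fin l → Bool) × (Fin t ⊕ Fin n → K)) :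
    run F sk.publicKey r (sk.signer r L) 𝒜 st (some o) = 0 := by
  induction 𝒜 generalizing st with
  | output M seed x =>
    rw [run, PMF.map_apply, ENNReal.tsum_eq_zero]
    intro y
    simp [hst]
  | arith op next ih => exact ih _ hst
  | test u a b iha ihb =>
    rw [run]
    split_ifs
    · exact iha _ hst
    · exact ihb _ hst
  | coin next ih =>
    rw [run, PMF.bind_apply, ENNReal.tsum_eq_zero]
    intro b
    exact mul_eq_zero_of_right _ (ih b _ hst)
  | randSmall next ih =>
    rw [run, PMF.bind_apply, ENNReal.tsum_eq_zero]
    intro b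
    exact mul_eq_zero_of_right _ (ih _ hst)
  | randLarge next ih =>
    rw [run, PMF.bind_apply, ENNReal.tsum_eq_zero]
    intro b
    exact mul_eq_zero_of_right _ (ih _ hst)
  | hash w next ih =>
    rw [run, PMF.bind_apply, ENNReal.tsum_eq_zero]
    intro b
    rw [ih _ (by simp [hst]), mul_zero]
  | sign M next ih =>
    rw [run]
    refine signer_bind_eq_zero sk r _ _ (by simp) ?_ L M st hst
    intro x seed st' hst'
    exact ih seed _ hst'

/-- Induction on the computation tree, for all pairs of related states. Every instruction other than
`sign` is matched exactly or contributes zero on the left; a signature request uses one factor `β`,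
by domination of the genuine law. -/
theorem mul_run_le_run_simulate {r' : ℕ} (hn : n = c * d) (hr' : r' * d ≤ c)
    (hm : (t + r') * (2 * d - 1) ≤ Module.finrank F K) (L : ℕ)
    (o : List Bool × (Fin l → Bool) × (Fin t ⊕ Fin n → K)) (𝒜 : Algorithm K n c t l) (N : ℕ)
    (hN : 𝒜.signCalls ≤ N) (st : State K c) (mem' : List K)
    (table' : List Bool → Option (Fin c → K)) (ρ : List (Operand n c t))
    (known : List Bool → Option (Fin c → Operand n c t))
    (h : Simulates l sk.publicKey st.signed st.mem st.table st.rejected mem' table' ρ known) :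
    ENNReal.ofReal (1 - 2 / ((Fintype.card F : ℝ) - 1)) ^ N *
        run F sk.publicKey (t + r') (sk.signer (t + r') L) 𝒜 st (some o) ≤
      run F sk.publicKey (t + r') noSigner
        (Algorithm.simulate (t + r') 𝒜 mem'.length ρ known) ⟨mem', table', [], [], true⟩
        (some o) := by
  set β := ENNReal.ofReal (1 - 2 / ((Fintype.card F : ℝ) - 1)) with hβ
  have hβ1 : β ≤ 1 := by
    rw [hβ, ENNReal.ofReal_le_one, sub_le_self_iff]
    have : (1 : ℝ) < Fintype.card F := by exact_mod_cast Fintype.one_lt_card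
    apply div_nonneg <;> linarith
  induction 𝒜 generalizing N st mem' table' ρ known with
  | output M seed x =>
    by_cases hf : st.fresh = true ∧ M ∉ st.signed
    · refine (mul_le_of_le_one_left' (pow_le_one' hβ1 N)).trans (le_of_eq ?_)
      rw [Algorithm.simulate, run, run,
        oracleValue_congr (h.table_eq_of_not_mem hf.2 seed)]
      have hx : (fun i => ((x i).rename mem'.length ρ).eval sk.publicKey mem') =
          fun i => (x i).eval sk.publicKey st.mem := by
        funext i
        rw [Operand.eval_rename, ← h.mem_eq]
      simp only [hx]
      refine congrArg (fun f => PMF.map f _ (some o)) (funext fun y => ?_)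
      congr! 1
      simp only [hf.1, hf.2, hx, List.not_mem_nil, not_false_eq_true, true_and]
    · rw [run, PMF.map_apply, ENNReal.tsum_eq_zero.2, mul_zero]
      · exact zero_le
      · intro y
        rw [if_neg]
        rw [if_neg fun h' => hf ⟨h'.1, h'.2.1⟩]
        simp
  | arith op next ih =>
    have h1 := h.extend_single (op.eval sk.publicKey st.mem)
    have := ih N hN { st with mem := st.mem ++ [op.eval sk.publicKey st.mem] } _ _ _ _ h1
    rw [run, Algorithm.simulate, run]
    simp only [Arith.eval_rename, ← h.mem_eq]
    simpa using this
  | test u a b iha ihb =>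
    simp only [Algorithm.signCalls, max_le_iff] at hN
    rw [run, Algorithm.simulate, run]
    have hu : (u.rename mem'.length ρ).eval sk.publicKey mem' = u.eval sk.publicKey st.mem := by
      rw [Operand.eval_rename, ← h.mem_eq]
    rw [hu]
    split_ifs
    · exact iha N hN.1 _ _ _ _ _ h
    · exact ihb N hN.2 _ _ _ _ _ h
  | coin next ih =>
    simp only [Algorithm.signCalls, max_le_iff] at hN
    rw [run, Algorithm.simulate, run, PMF.bind_apply, PMF.bind_apply, tsum_fintype, tsum_fintype,
      Finset.mul_sum]
    refine Finset.sum_le_sum fun b _ => ?_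
    rw [mul_left_comm]
    gcongr
    exact ih b N (by cases b <;> tauto) _ _ _ _ _ h
  | randSmall next ih =>
    rw [run, Algorithm.simulate, run, PMF.bind_apply, PMF.bind_apply, tsum_fintype, tsum_fintype,
      Finset.mul_sum]
    refine Finset.sum_le_sum fun b _ => ?_
    rw [mul_left_comm]
    gcongr
    have := ih N hN { st with mem := st.mem ++ [algebraMap F K b] } _ _ _ _
      (h.extend_single (algebraMap F K b))
    simpa using this
  | randLarge next ih =>
    rw [run, Algorithm.simulate, run, PMF.bind_apply, PMF.bind_apply, tsum_fintype, tsum_fintype,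
      Finset.mul_sum]
    refine Finset.sum_le_sum fun b _ => ?_
    rw [mul_left_comm]
    gcongr
    have := ih N hN { st with mem := st.mem ++ [b] } _ _ _ _ (h.extend_single b)
    simpa using this
  | hash w next ih =>
    -- If freshness is lost here, the left side vanishes. Otherwise `w` either has a chosen value,
    -- which the real table also holds, or has the same status in both tables.
    by_cases hf : st.fresh = true ∧ w ∉ st.rejected
    · rw [run, Algorithm.simulate]
      simp only [hf.1, hf.2, not_false_eq_true, decide_true, Bool.and_self]
      cases hk : known w with
      | some ys =>
        have ht := h.known_table w ys hk
        rw [oracleValue_of_some ht, PMF.pure_bind]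
        have h1 := h.extend [] (List.ofFn ys) (by
          intro u hu
          obtain ⟨i, rfl⟩ := List.mem_ofFn.1 hu
          simpa using h.known_bounded w ys hk i)
        rw [List.append_nil, List.map_ofFn] at h1
        rw [← ht, Function.update_eq_self]
        exact ih N hN { st with
          mem := st.mem ++ List.ofFn fun i => (ys i).eval sk.publicKey mem', fresh := true }
          _ _ _ _ h1
      | none =>
        simp only [run]
        rw [oracleValue_congr (h.table_eq w hk hf.2), PMF.bind_apply, PMF.bind_apply, tsum_fintype,
          tsum_fintype, Finset.mul_sum]
        refine Finset.sum_le_sum fun y _ => ?_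
        rw [mul_left_comm]
        gcongr
        have h1 := (h.hash hk y).extend (List.ofFn y)
          (List.ofFn fun i : Fin c => .reg (mem'.length + i)) (by
            intro u hu
            obtain ⟨i, rfl⟩ := List.mem_ofFn.1 hu
            simp [Operand.Bounded])
        have h2 : (List.ofFn fun i : Fin c => (Operand.reg (mem'.length + i) : Operand n c t)).map
            (Operand.eval sk.publicKey (mem' ++ List.ofFn y)) = List.ofFn y := by
          rw [List.map_ofFn]
          congr 1
          funext i
          have := Operand.eval_reg_append_ofFn (H' := sk.publicKey) mem' y [] i
          rwa [List.append_nil] at this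
        rw [h2] at h1
        have := ih N hN ⟨st.mem ++ List.ofFn y, Function.update st.table w (some y), st.signed,
          st.rejected, true⟩ _ _ _ _ h1
        simpa using this
    · rw [run, PMF.bind_apply, ENNReal.tsum_eq_zero.2, mul_zero]
      · exact zero_le
      · intro y
        rw [run_eq_zero_of_not_fresh sk L next _ _ o, mul_zero]
        simp only [Bool.and_eq_false_iff, decide_eq_false_iff_not]
        cases hfr : st.fresh <;> tauto
  | sign M next ih =>
    simp only [Algorithm.signCalls] at hN
    obtain ⟨N, rfl⟩ : ∃ k, N = k + 1 := ⟨N - 1, by omega⟩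
    have hle : ∀ seed, (next seed).signCalls ≤ N := fun seed =>
      (Finset.le_sup (f := fun seed => (next seed).signCalls) (Finset.mem_univ seed)).trans
        (Nat.le_of_succ_le_succ hN)
    -- The relation already counts `M` as signed, so that rejected inputs for `M` belong to a signed
    -- message before the signer succeeds.
    let I : State K c → Prop := fun st' => st'.signed = st.signed ∧
      Simulates l sk.publicKey (M :: st.signed) st'.mem st'.table st'.rejected mem' table' ρ known
    let final : (Fin l → Bool) → (Fin t ⊕ Fin n → K) → State K c → State K c :=
      fun seed x st' =>
        let st'' := st'.accept M (M ++ List.ofFn seed) (sk.publicKey.mulVec x)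
        { st'' with
          mem := st''.mem ++ List.ofFn (fun i => x (Sum.inl i)) ++
            List.ofFn (fun j => x (Sum.inr j)) }
    -- The real continuation depends on the rejected inputs, which the simulation does not see.
    -- Taking the supremum over all admissible states leaves a function of seed and signature alone.
    let m : (Fin l → Bool) → (Fin t ⊕ Fin n → K) → ℝ≥0∞ := fun seed x =>
      ⨆ (st' : State K c) (_ : I st'),
        run F sk.publicKey (t + r') (sk.signer (t + r') L) (next seed) (final seed x st') (some o)
    have hreal : run F sk.publicKey (t + r') (sk.signer (t + r') L) (.sign M next) st (some o) ≤
        ∑ seed : Fin l → Bool, (Fintype.card (Fin l → Bool) : ℝ≥0∞)⁻¹ *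
          ∑ x, sk.genuineLaw (t + r') (x, sk.publicKey.mulVec x) * m seed x := by
      rw [run]
      refine signer_bind_le sk (t + r') _ _ (by simp) ?_ M I m ?_ ?_ L st ⟨rfl, h.mono M⟩
      · intro x seed st' hst'
        exact run_eq_zero_of_not_fresh sk L (next seed) _ (by exact hst') o
      · intro st' seed y hst' hw
        exact ⟨hst'.1, hst'.2.reject List.mem_cons_self seed hw y⟩
      · intro st' seed x hst' _
        exact le_iSup₂_of_le st' hst' le_rfl
    have hsim : ∀ seed, (Fintype.card ((Fin (t + r') → K) ×
          (Fin t ⊕ Fin n → Fin (t + r') → F)) : ℝ≥0∞)⁻¹ *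
        ∑ p : (Fin (t + r') → K) × (Fin t ⊕ Fin n → Fin (t + r') → F),
          β ^ N * m seed (combine p) ≤
        run F sk.publicKey (t + r') noSigner
          (Algorithm.sample (t + r') mem'.length fun xs ys len' =>
            Algorithm.simulate (t + r') (next seed) len'
              (ρ ++ List.ofFn (fun i => xs (Sum.inl i)) ++ List.ofFn fun j => xs (Sum.inr j))
              (Function.update known (M ++ List.ofFn seed) (some ys)))
          ⟨mem', table', [], [], true⟩ (some o) := by
      intro seed
      refine run_sample ⟨mem', table', [], [], true⟩ (some o) _ (fun x => β ^ N * m seed x) ?_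
      intro x suf xs ys hxs hys hx hy
      simp only [m, ENNReal.mul_iSup]
      refine iSup₂_le fun st' hst' => ?_
      have h1 := (hst'.2.extend suf [] (by simp)).accept List.mem_cons_self seed ys hys
      have h2 := h1.extend [] (List.ofFn (fun i => xs (Sum.inl i)) ++
        List.ofFn fun j => xs (Sum.inr j)) (by
          intro u hu
          rcases List.mem_append.1 hu with hu | hu <;>
          · obtain ⟨i, rfl⟩ := List.mem_ofFn.1 hu
            simpa using hxs _)
      simp only [List.append_nil, List.map_nil, List.map_append, List.map_ofFn, Function.comp_def,
        hx, hy] at h2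
      refine ih seed N (hle seed) (final seed x st') (mem' ++ suf) table' _ _ ?_
      simp only [final, State.accept, hst'.1]
      simpa using h2
    calc _ ≤ β ^ (N + 1) * ∑ seed : Fin l → Bool, (Fintype.card (Fin l → Bool) : ℝ≥0∞)⁻¹ *
          ∑ x, sk.genuineLaw (t + r') (x, sk.publicKey.mulVec x) * m seed x := by
          gcongr
      _ = ∑ seed : Fin l → Bool, (Fintype.card (Fin l → Bool) : ℝ≥0∞)⁻¹ *
          (β * ∑ x, sk.genuineLaw (t + r') (x, sk.publicKey.mulVec x) * (β ^ N * m seed x)) := by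
          simp only [Finset.mul_sum]
          refine Finset.sum_congr rfl fun seed _ => Finset.sum_congr rfl fun x _ => ?_
          rw [pow_succ]
          ring
      _ ≤ _ := by
          rw [Algorithm.simulate, run_coins, Finset.mul_sum]
          exact Finset.sum_le_sum fun seed _ => mul_le_mul' le_rfl
            ((sk.sum_genuineLaw_le hn hr' hm _).trans (hsim seed))

end Comparison

/-! ### The constant 9. -/

/-- The base is the inverse of `1 + 2/(q-3)`, hence at least `exp(-2/(q-3))`. For `q ≥ 6` one has
`2N/(q-3) ≤ q/(q-3) ≤ 2`, and `e² < 9`. For `q < 6` one has `N ≤ 2` and base at least `1/3`;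
equality occurs at `q = 4`, `N = 2`. -/
theorem one_div_nine_le_pow {q N : ℕ} (hq : 4 ≤ q) (hN : 2 * N ≤ q) :
    (1 / 9 : ℝ) ≤ (1 - 2 / ((q : ℝ) - 1)) ^ N := by
  have h4 : (4 : ℝ) ≤ q := by exact_mod_cast hq
  by_cases h6 : 6 ≤ q
  · have h6' : (6 : ℝ) ≤ q := by exact_mod_cast h6
    have hN' : 2 * (N : ℝ) ≤ q := by exact_mod_cast hN
    have h1 : Real.exp (-(2 / ((q : ℝ) - 3))) ≤ 1 - 2 / ((q : ℝ) - 1) := by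
      have h := Real.add_one_le_exp (2 / ((q : ℝ) - 3))
      have e : 1 - 2 / ((q : ℝ) - 1) = (2 / ((q : ℝ) - 3) + 1)⁻¹ := by
        have h1 : (q : ℝ) - 1 ≠ 0 := by linarith
        have h3 : (q : ℝ) - 3 ≠ 0 := by linarith
        have h3' : 2 / ((q : ℝ) - 3) + 1 = (q - 1) / (q - 3) := by field_simp; ring
        rw [h3', inv_div]
        field_simp
        ring
      rw [Real.exp_neg, e]
      have : 0 ≤ 2 / ((q : ℝ) - 3) := div_nonneg (by norm_num) (by linarith)
      exact inv_anti₀ (by linarith) h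
    have h2 : (1 / 9 : ℝ) ≤ Real.exp (-2) := by
      have h := Real.exp_one_lt_d9
      have e : Real.exp 2 = Real.exp 1 * Real.exp 1 := by rw [← Real.exp_add]; norm_num
      rw [Real.exp_neg, one_div]
      apply inv_anti₀ (Real.exp_pos _)
      nlinarith [Real.exp_pos 1]
    calc (1 / 9 : ℝ) ≤ Real.exp (-2) := h2
      _ ≤ Real.exp (N * -(2 / ((q : ℝ) - 3))) := by
        apply Real.exp_le_exp.2
        have : (N : ℝ) * (2 / ((q : ℝ) - 3)) ≤ 2 := by
          rw [← mul_div_assoc, div_le_iff₀ (by linarith)]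
          linarith
        linarith
      _ = Real.exp (-(2 / ((q : ℝ) - 3))) ^ N := Real.exp_nat_mul _ _
      _ ≤ _ := pow_le_pow_left₀ (Real.exp_pos _).le h1 N
  · have hN2 : N ≤ 2 := by omega
    have h1 : (1 / 3 : ℝ) ≤ 1 - 2 / ((q : ℝ) - 1) := by
      rw [le_sub_comm, div_le_iff₀ (by linarith)]
      linarith
    calc (1 / 9 : ℝ) = (1 / 3) ^ 2 := by norm_num
      _ ≤ (1 / 3) ^ N := pow_le_pow_of_le_one (by norm_num) (by norm_num) hN2
      _ ≤ _ := pow_le_pow_left₀ (by norm_num) h1 N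

end RankSign

end

theorem theorem2 {F K : Type*} [Field F] [Field K] [Fintype F] [Fintype K] [Algebra F K]
    (n k d t r' l : ℕ) (hk : k ≤ n) (hn : n = (n - k) * d) (hr' : r' * d ≤ n - k)
    (hm : (t + r') * (2 * d - 1) ≤ Module.finrank F K) :
    (∀ sk : RankSign.SecretKey F K n (n - k) d t,
      ∃ h : (RankSign.rankVectors F K t n (t + r')).Nonempty,
        (RankSign.simulatedPair F sk.publicKey (t + r') h).toOuterMeasure
            {p | ¬ sk.Decodable (t + r') p.1}
          ≤ ENNReal.ofReal (2 / ((Fintype.card F : ℝ) - 1)) ∧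
        ∀ p : (Fin t ⊕ Fin n → K) × (Fin (n - k) → K),
          (sk.Decodable (t + r') p.1 →
            RankSign.simulatedPair F sk.publicKey (t + r') h p =
              (RankSign.simulatedPair F sk.publicKey (t + r') h).toOuterMeasure
                {p' | sk.Decodable (t + r') p'.1} * sk.genuineLaw (t + r') p) ∧
          (¬ sk.Decodable (t + r') p.1 → sk.genuineLaw (t + r') p = 0)) ∧
    (∀ (𝒜 : RankSign.Algorithm K n (n - k) t l) (N : ℕ), 𝒜.signCalls ≤ N →
      2 * N ≤ Fintype.card F →
      ∃ 𝒜' : RankSign.Algorithm K n (n - k) t l,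
        𝒜'.signCalls = 0 ∧ 𝒜'.hashCalls ≤ 𝒜.hashCalls ∧
        𝒜'.cost ≤ 𝒜.cost + N * (3 * (n + t + 1) * (t + r' + (n - k) + 1) + l) ∧
        ∀ (sk : RankSign.SecretKey F K n (n - k) d t)
          (o : List Bool × (Fin l → Bool) × (Fin t ⊕ Fin n → K)),
          ENNReal.ofReal (1 - 2 / ((Fintype.card F : ℝ) - 1)) ^ N *
              RankSign.forgeryProb sk (t + r') 𝒜 o
            ≤ RankSign.keyOnlyForgeryProb F sk.publicKey (t + r') 𝒜' o ∧
          (4 ≤ Fintype.card F →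
            RankSign.forgeryProb sk (t + r') 𝒜 o
              ≤ 9 * RankSign.keyOnlyForgeryProb F sk.publicKey (t + r') 𝒜' o)) := by
  refine ⟨fun sk => ?_, fun 𝒜 N hN hNq => ?_⟩
  · have h := sk.exists_rankWeight_eq hn hr' hm
    exact ⟨h, sk.toOuterMeasure_not_decodable_le hn hr' hm h, fun p =>
      ⟨sk.simulatedPair_eq_mul_genuineLaw h p, sk.genuineLaw_eq_zero p⟩⟩
  · have hb := RankSign.Algorithm.bounds_simulate (t + r') 𝒜 N hN 0 [] fun _ => none
    refine ⟨_, hb.signCalls, hb.hashCalls, hb.cost, fun sk o => ?_⟩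
    have hmain : ENNReal.ofReal (1 - 2 / ((Fintype.card F : ℝ) - 1)) ^ N *
        RankSign.forgeryProb sk (t + r') 𝒜 o ≤ RankSign.keyOnlyForgeryProb F sk.publicKey (t + r')
          (RankSign.Algorithm.simulate (t + r') 𝒜 0 [] fun _ => none) o := by
      -- The simulating algorithm and the bound do not depend on the limit `L` on the signer's
      -- attempts, so the supremum over `L` can be taken.
      rw [RankSign.forgeryProb, ENNReal.mul_iSup]
      exact iSup_le fun L => RankSign.mul_run_le_run_simulate sk hn hr' hm L o 𝒜 N hN
        (RankSign.State.init K (n - k)) [] (fun _ => none) [] (fun _ => none)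
        RankSign.Simulates.init
    refine ⟨hmain, fun hq => ?_⟩
    have h9 : (1 : ENNReal) ≤
        9 * ENNReal.ofReal (1 - 2 / ((Fintype.card F : ℝ) - 1)) ^ N := by
      have h0 : (0 : ℝ) ≤ 1 - 2 / ((Fintype.card F : ℝ) - 1) := by
        have : (4 : ℝ) ≤ Fintype.card F := by exact_mod_cast hq
        rw [sub_nonneg, div_le_one (by linarith)]
        linarith
      rw [← ENNReal.ofReal_pow h0, show (9 : ENNReal) = ENNReal.ofReal 9 by simp,
        ← ENNReal.ofReal_mul (by norm_num), ENNReal.one_le_ofReal]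
      linarith [RankSign.one_div_nine_le_pow hq hNq]
    calc RankSign.forgeryProb sk (t + r') 𝒜 o
        ≤ 9 * ENNReal.ofReal (1 - 2 / ((Fintype.card F : ℝ) - 1)) ^ N *
          RankSign.forgeryProb sk (t + r') 𝒜 o := le_mul_of_one_le_left' h9
      _ ≤ _ := by
        rw [mul_assoc]
        exact mul_le_mul_right hmain 9
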